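/- Let $n\in\mathbb N$, $G=\mathrm{GL}(n,\mathbb C)$, $\mathcal G=\mathfrak{gl}(n,\mathbb C)$, $\langle X,Y\rangle=\operatorname{tr}(XY)$, and $\mathfrak M=G\times\mathcal G$. For holomorphic $F$ on $\mathfrak M$ define the $\mathcal G$-valued derivatives by $$\langle\nabla_1F(g,L),X\rangle=\tfrac{d}{dz}\Big|_{0}F(e^{zX}g,L),\quad \langle\nabla_1'F(g,L),X\rangle=\tfrac{d}{dz}\Big|_{0}F(ge^{zX},L),\quad \langle d_2F(g,L),X\rangle=\tfrac{d}{dz}\Big|_{0}F(g,L+zX)$$ for all $X\in\mathcal G$, and $\nabla_2F=L\,d_2F$, $\nabla_2'F=(d_2F)L$. Let $r(X)=\frac12(X_>-X_<)$, where $X_>$, $X_<$ are the strictly upper and strictly lower triangular parts of $X$, and $r_\pm=r\pm\frac12\mathrm{id}$. Consider the Poisson brackets $$\{F,H\}_1=\langle\nabla_1F,d_2H\rangle-\langle\nabla_1H,d_2F\rangle+\langle L,[d_2F,d_2H]\rangle,$$ $$\{F,H\}_2=\langle r\nabla_1F,\nabla_1H\rangle-\langle r\nabla_1'F,\nabla_1'H\rangle+\langle\nabla_2F-\nabla_2'F,\,r_+\nabla_2'H-r_-\nabla_2H\rangle+\langle\nabla_1F,\,r_+\nabla_2'H-r_-\nabla_2H\rangle-\langle\nabla_1H,\,r_+\nabla_2'F-r_-\nabla_2F\rangle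 .$$ Let $\mathrm{Hol}(\mathfrak M)^G$ be the algebra of holomorphic functions on $\mathfrak M$ invariant under $(g,L)\mapsto(\eta g\eta^{-1},\eta L\eta^{-1})$ for all $\eta\in G$; let $\mathfrak M_0^{\rm reg}$ be the set of $(Q,L)\in\mathfrak M$ with $Q$ diagonal with pairwise distinct diagonal entries, let $\iota:\mathfrak M_0^{\rm reg}\to\mathfrak M$ be the inclusion, and let $\mathrm{Hol}(\mathfrak M)_{\rm red}=\{F\circ\iota : F\in\mathrm{Hol}(\mathfrak M)^G\}$. For $f\in\mathrm{Hol}(\mathfrak M)_{\rm red}$ let $\nabla_1f$ (diagonal-matrix valued) and $d_2f$ ($\mathcal G$-valued) be defined by $\langle\nabla_1f(Q,L),X_0\rangle=\frac{d}{dz}|_{0}f(e^{zX_0}Q,L)$ for all diagonal $X_0$ and $\langle d_2f(Q,L),X\rangle=\frac{d}{dz}|_{0}f(Q,L+zX)$ for all $X\in\mathcal G$, and put $\nabla_2f=L\,d_2f$, $\nabla_2'f=(d_2f)L$. For $Q$ diagonal and regular let $$\mathcal R(Q)X=\tfrac12(\mathrm{Ad}_Q+\mathrm{id})\circ(\mathrm{Ad}_Q-\mathrm{id})|_{\mathcal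 G_\perp}^{-1}X_\perp ,\qquad \mathrm{Ad}_Q X=QXQ^{-1},$$ where $\mathcal G_\perp$ is the space of matrices with zero diagonal and $X_\perp$ is the off-diagonal part of $X$, and let $[X,Y]_{\mathcal R(Q)}=[\mathcal R(Q)X,Y]+[X,\mathcal R(Q)Y]$. **Theorem.** For $i=1,2$ there is exactly one operation $\{\ ,\ \}_i^{\rm red}$ on $\mathrm{Hol}(\mathfrak M)_{\rm red}$ (with values in $\mathrm{Hol}(\mathfrak M)_{\rm red}$) such that $\{F\circ\iota,H\circ\iota\}_i^{\rm red}=\{F,H\}_i\circ\iota$ for all $F,H\in\mathrm{Hol}(\mathfrak M)^G$. For all $f,h\in\mathrm{Hol}(\mathfrak M)_{\rm red}$ and $(Q,L)\in\mathfrak M_0^{\rm reg}$, with all derivatives taken at $(Q,L)$, $$\{f,h\}_1^{\rm red}(Q,L)=\langle\nabla_1f,d_2h\rangle-\langle\nabla_1h,d_2f\rangle+\langle L,[d_2f,d_2h]_{\mathcal R(Q)}\rangle,$$ $$\{f,h\}_2^{\rm red}(Q,L)=\tfrac12\langle\nabla_1f,\nabla_2h+\nabla_2'h\rangle-\tfrac12\langle\nabla_1h,\nabla_2f+\nabla_2'f\rangle+\langle\nabla_2f,\mathcal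 R(Q)(\nabla_2h)\rangle-\langle\nabla_2'f,\mathcal R(Q)(\nabla_2'h)\rangle .$$ Both operations are Poisson brackets on the commutative algebra $\mathrm{Hol}(\mathfrak M)_{\rm red}$ (bilinear, antisymmetric, satisfying the Leibniz rule and the Jacobi identity), and they are compatible: $x\{\ ,\ \}_1^{\rm red}+y\{\ ,\ \}_2^{\rm red}$ is a Poisson bracket for all $x,y\in\mathbb C$. -/

import Mathlib

open Matrix

namespace SpinSutherland

/-! ### The group `GL(n, ℂ)`, its Lie algebra, and the standard `r`-matrix -/

/-- The Lie algebra `gl(n, ℂ)`. -/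
abbrev Mat (n : ℕ) : Type := Matrix (Fin n) (Fin n) ℂ

/-- The complex manifold `GL(n, ℂ) × gl(n, ℂ)` of pairs `(g, L)`. -/
abbrev Phase (n : ℕ) : Type := GL (Fin n) ℂ × Mat n

/-- The trace form on `gl(n, ℂ)`. -/
def pairing {n : ℕ} (X Y : Mat n) : ℂ := trace (X * Y)

/-- The strictly upper triangular part. -/
def upperPart {n : ℕ} (X : Mat n) : Mat n := Matrix.of fun i j => if i < j then X i j else 0

/-- The strictly lower triangular part. -/
def lowerPart {n : ℕ} (X : Mat n) : Mat n := Matrix.of fun i j => if j < i then X i j else 0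

/-- The standard solution of the modified classical Yang--Baxter equation. -/
noncomputable def rMat {n : ℕ} (X : Mat n) : Mat n := (1 / 2 : ℂ) • (upperPart X - lowerPart X)

/-- `r + id / 2`. -/
noncomputable def rPlus {n : ℕ} (X : Mat n) : Mat n := rMat X + (1 / 2 : ℂ) • X

/-- `r - id / 2`. -/
noncomputable def rMinus {n : ℕ} (X : Mat n) : Mat n := rMat X - (1 / 2 : ℂ) • X

/-- The exponential map `gl(n, ℂ) → GL(n, ℂ)`. -/
noncomputable def expGL {n : ℕ} (X : Mat n) : GL (Fin n) ℂ := (Matrix.isUnit_exp X).unit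

/-! ### Holomorphic functions on the phase space and their derivatives -/

/-- Holomorphic functions on `GL(n, ℂ) × gl(n, ℂ)`, viewed as an open subset of the complex vector
space `gl(n, ℂ) × gl(n, ℂ)`. -/
def IsHol {n : ℕ} (F : Phase n → ℂ) : Prop :=
  ∃ Φ : Mat n × Mat n → ℂ, DifferentiableOn ℂ Φ {p | IsUnit p.1} ∧
    ∀ (g : GL (Fin n) ℂ) (L : Mat n), F (g, L) = Φ ((g : Mat n), L)

/-- The `gl(n, ℂ)`-valued derivative `∇₁ F`: the entries are chosen such that
`⟨∇₁ F (g, L), X⟩ = d/dz F (exp (z X) g, L)` at `z = 0` (see `pairing_grad1`). -/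
noncomputable def grad1 {n : ℕ} (F : Phase n → ℂ) (p : Phase n) : Mat n :=
  Matrix.of fun i j => deriv (fun z : ℂ => F (expGL (z • Matrix.single j i (1 : ℂ)) * p.1, p.2)) 0

/-- The `gl(n, ℂ)`-valued derivative `∇₁' F`:
`⟨∇₁' F (g, L), X⟩ = d/dz F (g exp (z X), L)` at `z = 0` (see `pairing_grad1'`). -/
noncomputable def grad1' {n : ℕ} (F : Phase n → ℂ) (p : Phase n) : Mat n :=
  Matrix.of fun i j => deriv (fun z : ℂ => F (p.1 * expGL (z • Matrix.single j i (1 : ℂ)), p.2)) 0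

/-- The `gl(n, ℂ)`-valued derivative `d₂ F`:
`⟨d₂ F (g, L), X⟩ = d/dz F (g, L + z X)` at `z = 0` (see `pairing_d2`). -/
noncomputable def d2 {n : ℕ} (F : Phase n → ℂ) (p : Phase n) : Mat n :=
  Matrix.of fun i j => deriv (fun z : ℂ => F (p.1, p.2 + z • Matrix.single j i (1 : ℂ))) 0

/-- `∇₂ F = L d₂ F`. -/
noncomputable def grad2 {n : ℕ} (F : Phase n → ℂ) (p : Phase n) : Mat n := p.2 * d2 F p

/-- `∇₂' F = (d₂ F) L`. -/
noncomputable def grad2' {n : ℕ} (F : Phase n → ℂ) (p : Phase n) : Mat n := d2 F p * p.2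

section DefiningRelations

/-! The relations that define the derivatives of holomorphic functions hold for all directions. -/

open scoped Matrix.Norms.Operator

theorem trace_dual {n : ℕ} (φ : Mat n →ₗ[ℂ] ℂ) (X : Mat n) :
    pairing (Matrix.of fun i j => φ (Matrix.single j i (1 : ℂ))) X = φ X := by
  conv_rhs => rw [Matrix.matrix_eq_sum_single X]
  simp only [pairing, trace, diag_apply, mul_apply, of_apply, map_sum]
  rw [Finset.sum_comm]
  refine Finset.sum_congr rfl fun i _ => Finset.sum_congr rfl fun j _ => ?_
  have : Matrix.single i j (X i j) = X i j • Matrix.single i j (1 : ℂ) := by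
    rw [Matrix.smul_single]; simp
  rw [this, map_smul, smul_eq_mul, mul_comm]

theorem isHol_hasFDerivAt {n : ℕ} {F : Phase n → ℂ} (hF : IsHol F) (p : Phase n) :
    ∃ (Φ : Mat n × Mat n → ℂ) (Φ' : Mat n × Mat n →L[ℂ] ℂ),
      (∀ q : Phase n, F q = Φ ((q.1 : Mat n), q.2)) ∧ HasFDerivAt Φ Φ' ((p.1 : Mat n), p.2) := by
  obtain ⟨Φ, h1, h2⟩ := hF
  have ho : IsOpen {q : Mat n × Mat n | IsUnit q.1} := Units.isOpen.preimage continuous_fst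
  have hd : DifferentiableAt ℂ Φ ((p.1 : Mat n), p.2) :=
    (h1 _ p.1.isUnit).differentiableAt (ho.mem_nhds p.1.isUnit)
  exact ⟨Φ, _, fun q => h2 q.1 q.2, hd.hasFDerivAt⟩

theorem hasDerivAt_expGL {n : ℕ} (X : Mat n) :
    HasDerivAt (fun z : ℂ => ((expGL (z • X) : GL (Fin n) ℂ) : Mat n)) X 0 := by
  have h := hasDerivAt_exp_smul_const (𝕂 := ℂ) X (0 : ℂ)
  rw [zero_smul, NormedSpace.exp_zero, one_mul] at h
  exact h

theorem pairing_grad1 {n : ℕ} {F : Phase n → ℂ} (hF : IsHol F) (p : Phase n) (X : Mat n) :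
    HasDerivAt (fun z : ℂ => F (expGL (z • X) * p.1, p.2)) (pairing (grad1 F p) X) 0 := by
  obtain ⟨Φ, Φ', h1, h2⟩ := isHol_hasFDerivAt hF p
  have key : ∀ Y : Mat n, HasDerivAt (fun z : ℂ => F (expGL (z • Y) * p.1, p.2))
      (Φ' (Y * (p.1 : Mat n), 0)) 0 := by
    intro Y
    have hc : HasDerivAt (fun z : ℂ => ((expGL (z • Y) : Mat n) * (p.1 : Mat n), p.2))
        (Y * (p.1 : Mat n), 0) 0 :=
      ((hasDerivAt_expGL Y).mul_const _).prodMk (hasDerivAt_const _ _)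
    have h0 : ((p.1 : Mat n), p.2) = ((expGL ((0 : ℂ) • Y) : Mat n) * (p.1 : Mat n), p.2) := by
      simp [expGL]
    rw [h0] at h2
    have := h2.comp_hasDerivAt (0 : ℂ) hc
    rw [funext fun z : ℂ => h1 _]
    exact this
  let φ : Mat n →ₗ[ℂ] ℂ :=
    { toFun := fun Y => Φ' (Y * (p.1 : Mat n), 0)
      map_add' := fun Y Z => by rw [← map_add]; simp [add_mul]
      map_smul' := fun c Y => by rw [RingHom.id_apply, ← map_smul]; simp }
  have hg : grad1 F p = Matrix.of fun i j => φ (Matrix.single j i (1 : ℂ)) := by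
    ext i j; exact (key _).deriv
  rw [hg, trace_dual]
  exact key X

theorem pairing_grad1' {n : ℕ} {F : Phase n → ℂ} (hF : IsHol F) (p : Phase n) (X : Mat n) :
    HasDerivAt (fun z : ℂ => F (p.1 * expGL (z • X), p.2)) (pairing (grad1' F p) X) 0 := by
  obtain ⟨Φ, Φ', h1, h2⟩ := isHol_hasFDerivAt hF p
  have key : ∀ Y : Mat n, HasDerivAt (fun z : ℂ => F (p.1 * expGL (z • Y), p.2))
      (Φ' ((p.1 : Mat n) * Y, 0)) 0 := by
    intro Y
    have hc : HasDerivAt (fun z : ℂ => ((p.1 : Mat n) * (expGL (z • Y) : Mat n), p.2))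
        ((p.1 : Mat n) * Y, 0) 0 :=
      ((hasDerivAt_expGL Y).const_mul _).prodMk (hasDerivAt_const _ _)
    have h0 : ((p.1 : Mat n), p.2) = ((p.1 : Mat n) * (expGL ((0 : ℂ) • Y) : Mat n), p.2) := by
      simp [expGL]
    rw [h0] at h2
    have := h2.comp_hasDerivAt (0 : ℂ) hc
    rw [funext fun z : ℂ => h1 _]
    exact this
  let φ : Mat n →ₗ[ℂ] ℂ :=
    { toFun := fun Y => Φ' ((p.1 : Mat n) * Y, 0)
      map_add' := fun Y Z => by rw [← map_add]; simp [mul_add]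
      map_smul' := fun c Y => by rw [RingHom.id_apply, ← map_smul]; simp }
  have hg : grad1' F p = Matrix.of fun i j => φ (Matrix.single j i (1 : ℂ)) := by
    ext i j; exact (key _).deriv
  rw [hg, trace_dual]
  exact key X

theorem pairing_d2 {n : ℕ} {F : Phase n → ℂ} (hF : IsHol F) (p : Phase n) (X : Mat n) :
    HasDerivAt (fun z : ℂ => F (p.1, p.2 + z • X)) (pairing (d2 F p) X) 0 := by
  obtain ⟨Φ, Φ', h1, h2⟩ := isHol_hasFDerivAt hF p
  have key : ∀ Y : Mat n, HasDerivAt (fun z : ℂ => F (p.1, p.2 + z • Y)) (Φ' (0, Y)) 0 := by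
    intro Y
    have hY : HasDerivAt (fun z : ℂ => p.2 + z • Y) Y 0 := by
      have h := ((hasDerivAt_id (0 : ℂ)).smul_const Y).const_add p.2
      rw [one_smul] at h
      exact h
    have hc : HasDerivAt (fun z : ℂ => ((p.1 : Mat n), p.2 + z • Y)) (0, Y) 0 :=
      (hasDerivAt_const _ _).prodMk hY
    have h0 : ((p.1 : Mat n), p.2) = ((p.1 : Mat n), p.2 + (0 : ℂ) • Y) := by simp
    rw [h0] at h2
    have := h2.comp_hasDerivAt (0 : ℂ) hc
    rw [funext fun z : ℂ => h1 _]
    exact this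
  let φ : Mat n →ₗ[ℂ] ℂ :=
    { toFun := fun Y => Φ' (0, Y)
      map_add' := fun Y Z => by rw [← map_add]; simp
      map_smul' := fun c Y => by rw [RingHom.id_apply, ← map_smul]; simp }
  have hg : d2 F p = Matrix.of fun i j => φ (Matrix.single j i (1 : ℂ)) := by
    ext i j; exact (key _).deriv
  rw [hg, trace_dual]
  exact key X

end DefiningRelations

/-! ### The two brackets on the phase space -/

/-- The first bracket (canonical bracket of the cotangent bundle). -/
noncomputable def bracket1 {n : ℕ} (F H : Phase n → ℂ) (p : Phase n) : ℂ :=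
  pairing (grad1 F p) (d2 H p) - pairing (grad1 H p) (d2 F p)
    + pairing p.2 (d2 F p * d2 H p - d2 H p * d2 F p)

/-- The second bracket. -/
noncomputable def bracket2 {n : ℕ} (F H : Phase n → ℂ) (p : Phase n) : ℂ :=
  pairing (rMat (grad1 F p)) (grad1 H p) - pairing (rMat (grad1' F p)) (grad1' H p)
    + pairing (grad2 F p - grad2' F p) (rPlus (grad2' H p) - rMinus (grad2 H p))
    + pairing (grad1 F p) (rPlus (grad2' H p) - rMinus (grad2 H p))
    - pairing (grad1 H p) (rPlus (grad2' F p) - rMinus (grad2 F p))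

/-! ### Invariant functions and their restrictions -/

/-- The commutative algebra of holomorphic functions on the phase space that are invariant under
simultaneous conjugation `(g, L) ↦ (η g η⁻¹, η L η⁻¹)`. -/
def holInv (n : ℕ) : Subalgebra ℂ (Phase n → ℂ) where
  carrier := {F | IsHol F ∧ ∀ (η g : GL (Fin n) ℂ) (L : Mat n),
    F (η * g * η⁻¹, (η : Mat n) * L * ((η⁻¹ : GL (Fin n) ℂ) : Mat n)) = F (g, L)}
  mul_mem' := by
    open scoped Matrix.Norms.Operator in
    rintro F H ⟨⟨Φ, h1, h2⟩, h3⟩ ⟨⟨Ψ, k1, k2⟩, k3⟩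
    exact ⟨⟨Φ * Ψ, h1.mul k1, fun g L => by simp [h2, k2]⟩,
      fun η g L => by simp only [Pi.mul_apply, h3, k3]⟩
  add_mem' := by
    open scoped Matrix.Norms.Operator in
    rintro F H ⟨⟨Φ, h1, h2⟩, h3⟩ ⟨⟨Ψ, k1, k2⟩, k3⟩
    exact ⟨⟨Φ + Ψ, h1.add k1, fun g L => by simp [h2, k2]⟩,
      fun η g L => by simp only [Pi.add_apply, h3, k3]⟩
  algebraMap_mem' := by
    open scoped Matrix.Norms.Operator in
    intro c
    exact ⟨⟨fun _ => c, differentiableOn_const c, fun g L => rfl⟩, fun η g L => rfl⟩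

/-- Diagonal elements of `GL(n, ℂ)` with pairwise distinct diagonal entries. -/
def IsRegDiag {n : ℕ} (Q : GL (Fin n) ℂ) : Prop :=
  (Q : Mat n).IsDiag ∧ ∀ i j : Fin n, i ≠ j → (Q : Mat n) i i ≠ (Q : Mat n) j j

/-- The set of pairs `(Q, L)` with `Q` diagonal and regular. -/
abbrev RegPhase (n : ℕ) : Type := {p : Phase n // IsRegDiag p.1}

/-- Restriction of functions (pull-back by the tautological embedding). -/
def restrict (n : ℕ) : (Phase n → ℂ) →ₐ[ℂ] (RegPhase n → ℂ) where
  toFun F := fun p => F p.1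
  map_one' := rfl
  map_mul' _ _ := rfl
  map_zero' := rfl
  map_add' _ _ := rfl
  commutes' _ := rfl

/-- The algebra of restrictions of invariant holomorphic functions. -/
def holRed (n : ℕ) : Subalgebra ℂ (RegPhase n → ℂ) := (holInv n).map (restrict n)

/-- Restriction as a map from invariant functions onto the reduced algebra. -/
def restrictInv {n : ℕ} (F : holInv n) : holRed n :=
  ⟨restrict n F.1, Subalgebra.mem_map.mpr ⟨F.1, F.2, rfl⟩⟩

/-- `b` is the bracket on the reduced algebra induced by the bracket `B` of functions on the phase
space: the `b`-bracket of the restrictions of `F` and `H` is the restriction of `B F H`. -/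
def IsReducedBracket {n : ℕ} (B : (Phase n → ℂ) → (Phase n → ℂ) → Phase n → ℂ)
    (b : holRed n → holRed n → holRed n) : Prop :=
  ∀ F H : holInv n, (b (restrictInv F) (restrictInv H) : RegPhase n → ℂ) = restrict n (B F H)

/-! ### Derivatives of functions of `(Q, L)` -/

/-- Extension by zero of a function of `(Q, L)`; only its values near points of the original domain
and along directions tangent to it are ever used. -/
noncomputable def extendZero {n : ℕ} (f : RegPhase n → ℂ) : Phase n → ℂ :=
  Function.extend Subtype.val f 0

/-- The derivative `∇₁ f` with values in the diagonal matrices: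
`⟨∇₁ f (Q, L), X⟩ = d/dz f (exp (z X) Q, L)` at `z = 0` for diagonal `X`
(see `pairing_redGrad1`). -/
noncomputable def redGrad1 {n : ℕ} (f : RegPhase n → ℂ) (p : RegPhase n) : Mat n :=
  Matrix.diagonal fun i => deriv (fun z : ℂ =>
    extendZero f (expGL (z • Matrix.single i i (1 : ℂ)) * p.1.1, p.1.2)) 0

/-- The derivative `d₂ f`: `⟨d₂ f (Q, L), X⟩ = d/dz f (Q, L + z X)` at `z = 0`
(see `pairing_redD2`). -/
noncomputable def redD2 {n : ℕ} (f : RegPhase n → ℂ) (p : RegPhase n) : Mat n :=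
  Matrix.of fun i j =>
    deriv (fun z : ℂ => f ⟨(p.1.1, p.1.2 + z • Matrix.single j i (1 : ℂ)), p.2⟩) 0

/-- `∇₂ f = L d₂ f`. -/
noncomputable def redGrad2 {n : ℕ} (f : RegPhase n → ℂ) (p : RegPhase n) : Mat n :=
  p.1.2 * redD2 f p

/-- `∇₂' f = (d₂ f) L`. -/
noncomputable def redGrad2' {n : ℕ} (f : RegPhase n → ℂ) (p : RegPhase n) : Mat n :=
  redD2 f p * p.1.2

theorem pairing_redD2 {n : ℕ} {f : RegPhase n → ℂ} (hf : f ∈ holRed n) (p : RegPhase n)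
    (X : Mat n) :
    HasDerivAt (fun z : ℂ => f ⟨(p.1.1, p.1.2 + z • X), p.2⟩) (pairing (redD2 f p) X) 0 := by
  obtain ⟨F, hF, rfl⟩ := Subalgebra.mem_map.mp hf
  exact pairing_d2 hF.1 p.1 X

theorem expGL_mul_regDiag {n : ℕ} (Q : GL (Fin n) ℂ) (hQ : IsRegDiag Q) (x : Fin n → ℂ) :
    ∀ᶠ z : ℂ in nhds 0, IsRegDiag (expGL (z • Matrix.diagonal x) * Q) := by
  have hent : ∀ (z : ℂ) (i j : Fin n),
      ((expGL (z • Matrix.diagonal x) * Q : GL (Fin n) ℂ) : Mat n) i j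
        = Complex.exp (z * x i) * (Q : Mat n) i j := by
    intro z i j
    have : ((expGL (z • Matrix.diagonal x) : GL (Fin n) ℂ) : Mat n)
        = Matrix.diagonal fun i => Complex.exp (z * x i) := by
      rw [← Matrix.diagonal_smul]
      simp only [expGL, IsUnit.unit_spec, Matrix.exp_diagonal]
      congr 1
      funext i
      rw [Pi.coe_exp, Complex.exp_eq_exp_ℂ]
      rfl
    rw [Units.val_mul, this, Matrix.diagonal_mul]
  have hne : ∀ i j : Fin n, ∀ᶠ z : ℂ in nhds 0, i ≠ j →
      Complex.exp (z * x i) * (Q : Mat n) i i ≠ Complex.exp (z * x j) * (Q : Mat n) j j := by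
    intro i j
    by_cases hij : i = j
    · simp [hij]
    have hc : ContinuousAt (fun z : ℂ => Complex.exp (z * x i) * (Q : Mat n) i i
        - Complex.exp (z * x j) * (Q : Mat n) j j) 0 := by fun_prop
    have h0 := hc.eventually_ne (y := 0) (by simpa using sub_ne_zero.mpr (hQ.2 i j hij))
    filter_upwards [h0] with z hz _ using sub_ne_zero.mp hz
  have := Filter.eventually_all.mpr fun i => Filter.eventually_all.mpr (hne i)
  filter_upwards [this] with z hz
  refine ⟨fun i j hij => ?_, fun i j hij => ?_⟩
  · exact (hent z i j).trans (by rw [hQ.1 hij, mul_zero])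
  · simpa only [hent] using hz i j hij

theorem pairing_redGrad1 {n : ℕ} {f : RegPhase n → ℂ} (hf : f ∈ holRed n) (p : RegPhase n)
    (x : Fin n → ℂ) :
    HasDerivAt (fun z : ℂ => extendZero f (expGL (z • Matrix.diagonal x) * p.1.1, p.1.2))
      (pairing (redGrad1 f p) (Matrix.diagonal x)) 0 := by
  obtain ⟨F, hF, rfl⟩ := Subalgebra.mem_map.mp hf
  have key : ∀ y : Fin n → ℂ, HasDerivAt
      (fun z : ℂ => extendZero (restrict n F) (expGL (z • Matrix.diagonal y) * p.1.1, p.1.2))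
      (pairing (grad1 F p.1) (Matrix.diagonal y)) 0 := by
    intro y
    refine (pairing_grad1 hF.1 p.1 (Matrix.diagonal y)).congr_of_eventuallyEq ?_
    filter_upwards [expGL_mul_regDiag p.1.1 p.2 y] with z hz
    exact Subtype.val_injective.extend_apply (restrict n F) 0
      (⟨(expGL (z • Matrix.diagonal y) * p.1.1, p.1.2), hz⟩ : RegPhase n)
  have hg : redGrad1 (restrict n F) p = Matrix.diagonal fun i => grad1 F p.1 i i := by
    refine congrArg Matrix.diagonal (funext fun i => ?_)
    have := (key (Pi.single i 1)).deriv
    rw [Matrix.diagonal_single] at this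
    rw [this, pairing, Matrix.trace_mul_single]
    simp
  have hp : pairing (redGrad1 (restrict n F) p) (Matrix.diagonal x)
      = pairing (grad1 F p.1) (Matrix.diagonal x) := by
    rw [hg]
    simp [pairing, trace, Matrix.mul_diagonal]
  rw [hp]
  exact key x

/-! ### The dynamical `r`-matrix -/

/-- The space of matrices with vanishing diagonal part. -/
def offDiag (n : ℕ) : Submodule ℂ (Mat n) where
  carrier := {X | ∀ i, X i i = 0}
  add_mem' hX hY i := by simp [hX i, hY i]
  zero_mem' _ := rfl
  smul_mem' c X hX i := by simp [hX i]

/-- The off-diagonal part of a matrix. -/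
def offDiagPart {n : ℕ} (X : Mat n) : offDiag n :=
  ⟨X - Matrix.diagonal (Matrix.diag X), fun i => by simp⟩

/-- `Ad_Q X = Q X Q⁻¹`. -/
def Ad {n : ℕ} (Q : GL (Fin n) ℂ) : Mat n →ₗ[ℂ] Mat n where
  toFun X := (Q : Mat n) * X * ((Q⁻¹ : GL (Fin n) ℂ) : Mat n)
  map_add' X Y := by simp [mul_add, add_mul]
  map_smul' c X := by simp

theorem regDiag_ad_mul {n : ℕ} {Q : GL (Fin n) ℂ} (hQ : IsRegDiag Q) (X : Mat n) (i j : Fin n) :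
    Ad Q X i j * (Q : Mat n) j j = (Q : Mat n) i i * X i j := by
  have hd : Matrix.diagonal (Matrix.diag (Q : Mat n)) = (Q : Mat n) := hQ.1.diagonal_diag
  have h : Ad Q X * (Q : Mat n) = (Q : Mat n) * X := by
    change (Q : Mat n) * X * ((Q⁻¹ : GL (Fin n) ℂ) : Mat n) * (Q : Mat n) = _
    rw [mul_assoc, ← Units.val_mul, inv_mul_cancel, Units.val_one, mul_one]
  have h' := congrFun (congrFun h i) j
  rw [← hd, Matrix.mul_diagonal, Matrix.diagonal_mul] at h'
  exact h'

theorem regDiag_ne_zero {n : ℕ} {Q : GL (Fin n) ℂ} (hQ : IsRegDiag Q) (i : Fin n) :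
    (Q : Mat n) i i ≠ 0 := by
  intro h0
  have hd : Matrix.diagonal (Matrix.diag (Q : Mat n)) = (Q : Mat n) := hQ.1.diagonal_diag
  have h : (Q : Mat n) * ((Q⁻¹ : GL (Fin n) ℂ) : Mat n) = 1 := by
    rw [← Units.val_mul, mul_inv_cancel, Units.val_one]
  have h' := congrFun (congrFun h i) i
  rw [← hd, Matrix.diagonal_mul, Matrix.diag_apply, h0] at h'
  simp at h'

/-- For `Q` diagonal, `Ad_Q - id` maps off-diagonal matrices to off-diagonal matrices. -/
theorem regDiag_mapsTo {n : ℕ} {Q : GL (Fin n) ℂ} (hQ : IsRegDiag Q) :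
    ∀ X ∈ offDiag n, (Ad Q - LinearMap.id : Mat n →ₗ[ℂ] Mat n) X ∈ offDiag n := by
  intro X hX i
  have h := regDiag_ad_mul hQ X i i
  rw [hX i, mul_zero] at h
  have := (mul_eq_zero.mp h).resolve_right (regDiag_ne_zero hQ i)
  simp [this, hX i]

/-- For `Q` diagonal and regular, `Ad_Q - id` is injective on off-diagonal matrices. -/
theorem regDiag_injective {n : ℕ} {Q : GL (Fin n) ℂ} (hQ : IsRegDiag Q) :
    Function.Injective
      ((Ad Q - LinearMap.id : Mat n →ₗ[ℂ] Mat n).restrict (regDiag_mapsTo hQ)) := by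
  rw [← LinearMap.ker_eq_bot, LinearMap.ker_eq_bot']
  intro X hX
  have h : Ad Q X.1 = X.1 := by
    have := congrArg Subtype.val hX
    exact sub_eq_zero.mp this
  ext i j
  by_cases hij : i = j
  · subst hij; exact X.2 i
  have h' := regDiag_ad_mul hQ X.1 i j
  rw [h, mul_comm] at h'
  by_contra h0
  exact hQ.2 i j hij (mul_right_cancel₀ h0 h').symm

/-- For `Q` diagonal and regular, the invertible operator `Ad_Q - id` on off-diagonal matrices. -/
noncomputable def adSubId {n : ℕ} (Q : GL (Fin n) ℂ) (hQ : IsRegDiag Q) :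
    offDiag n ≃ₗ[ℂ] offDiag n :=
  LinearEquiv.ofInjectiveEndo
    ((Ad Q - LinearMap.id : Mat n →ₗ[ℂ] Mat n).restrict (regDiag_mapsTo hQ))
    (regDiag_injective hQ)

/-- The dynamical `r`-matrix `R(Q) X = ½ (Ad_Q + id) (Ad_Q - id)⁻¹ X_⊥`, where `X_⊥` is the
off-diagonal part of `X` and the inverse is taken on off-diagonal matrices. -/
noncomputable def dynR {n : ℕ} (Q : GL (Fin n) ℂ) (hQ : IsRegDiag Q) (X : Mat n) : Mat n :=
  (1 / 2 : ℂ) • (Ad Q + LinearMap.id : Mat n →ₗ[ℂ] Mat n)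
    ((adSubId Q hQ).symm (offDiagPart X) : Mat n)

/-- `[X, Y]_{R(Q)} = [R(Q) X, Y] + [X, R(Q) Y]`. -/
noncomputable def dynBracket {n : ℕ} (Q : GL (Fin n) ℂ) (hQ : IsRegDiag Q) (X Y : Mat n) : Mat n :=
  (dynR Q hQ X * Y - Y * dynR Q hQ X) + (X * dynR Q hQ Y - dynR Q hQ Y * X)

/-! ### Poisson brackets on a commutative algebra -/

/-- Poisson brackets on a commutative algebra: bilinear, antisymmetric operations that are
derivations in each argument and satisfy the Jacobi identity. -/
structure IsPoissonBracket {A : Type*} [CommRing A] [Algebra ℂ A] (b : A → A → A) : Prop where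
  add_left : ∀ f g h, b (f + g) h = b f h + b g h
  smul_left : ∀ (c : ℂ) f h, b (c • f) h = c • b f h
  antisymm : ∀ f h, b f h = -b h f
  leibniz : ∀ f g h, b (f * g) h = f * b g h + b f h * g
  jacobi : ∀ f g h, b f (b g h) + b g (b h f) + b h (b f g) = 0

/-- Two Poisson brackets are compatible if all their linear combinations are Poisson brackets. -/
def AreCompatible {A : Type*} [CommRing A] [Algebra ℂ A] (b₁ b₂ : A → A → A) : Prop :=
  ∀ x y : ℂ, IsPoissonBracket fun f h => x • b₁ f h + y • b₂ f h

end SpinSutherland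

namespace SpinSutherland

/-! ### Derivatives of holomorphic functions of several variables -/

section SeveralVariables

open Metric MeasureTheory Filter Topology

variable {E : Type*} [NormedAddCommGroup E] [NormedSpace ℂ E]

/-! On invariant functions both brackets come from one expression. Infinitesimal invariance reads
`∇₁'F = ∇₁F + [L, d₂F]`. It cancels every `r`-term of the second bracket by skewness of `r`
(`rMat_cancellation`), leaving `tensor` at `M = L`. Since `tensor` is quadratic in `M`, replacing
`L` by `L + c` yields exactly `{F, H}₂ + c {F, H}₁` (`bracket1_eq_pencil`), so a single Jacobi
identity, valid for every `c`, handles both brackets and their compatibility.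

In that Jacobi identity the second-derivative terms cancel by symmetry of the Hessian. What remains
is the difference of the Cartan `3`-form on left and right gradients, shifted by commutators with
`M` (`cyclic_tensorDeriv`). Invariance turns the shifted left gradient `g ∂F/∂g + [M, d₂F]` into the
right gradient `∂F/∂g g`, and cyclicity of the trace makes the difference vanish. The analytic input
is that partial derivatives of holomorphic functions are again holomorphic
(`differentiableAt_fderiv_apply`).

For the reduction, at regular diagonal `Q` invariance fixes the off-diagonal part of `∇₁F` in terms
of `d₂F` through `R(Q)` (`grad1_eq_redGrad1_add`). Substitution gives the two formulas. They involve
only the restrictions, so the brackets descend, and the Poisson axioms for all `b₂ + c b₁` descend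
with them. Finally, comparing different values of `c` gives the axioms for `b₁` and for every linear
combination. -/

theorem hasDerivAt_line (x v : E) (w : ℂ) : HasDerivAt (fun z : ℂ => x + z • v) v w := by
  have h := ((hasDerivAt_id w).smul_const v).const_add x
  rwa [one_smul] at h

theorem hasDerivAt_comp_line {F : Type*} [NormedAddCommGroup F] [NormedSpace ℂ F] {f : E → F}
    {x : E} (hf : DifferentiableAt ℂ f x) (v : E) :
    HasDerivAt (fun z : ℂ => f (x + z • v)) (fderiv ℂ f x v) 0 := by
  have h : HasFDerivAt f (fderiv ℂ f x) (x + (0 : ℂ) • v) := by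
    simpa using hf.hasFDerivAt
  exact h.comp_hasDerivAt 0 (hasDerivAt_line x v 0)

/-- **Cauchy's estimate** for the derivative of a holomorphic function of several variables. -/
theorem norm_fderiv_le_of_norm_le {Φ : E → ℂ} {x : E} {ρ C : ℝ} (hρ : 0 < ρ)
    (hd : ∀ y ∈ closedBall x ρ, DifferentiableAt ℂ Φ y) (hC : ∀ y ∈ closedBall x ρ, ‖Φ y‖ ≤ C) :
    ‖fderiv ℂ Φ x‖ ≤ C / ρ := by
  have hC0 : 0 ≤ C := (norm_nonneg _).trans (hC x (mem_closedBall_self hρ.le))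
  refine ContinuousLinearMap.opNorm_le_bound _ (div_nonneg hC0 hρ.le) fun v => ?_
  by_cases hv : v = 0
  · simp [hv]
  have hv' : 0 < ‖v‖ := norm_pos_iff.mpr hv
  -- The one-variable estimate is applied on the complex line through `x` in direction `v`, where `ρ
  -- / ‖v‖` is the largest radius staying in the ball.
  have hmem : ∀ z ∈ closedBall (0 : ℂ) (ρ / ‖v‖), x + z • v ∈ closedBall x ρ := by
    intro z hz
    rw [mem_closedBall_zero_iff, le_div_iff₀ hv'] at hz
    simpa [mem_closedBall, dist_eq_norm, norm_smul] using hz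
  have hder : ∀ z ∈ closedBall (0 : ℂ) (ρ / ‖v‖),
      HasDerivAt (fun z : ℂ => Φ (x + z • v)) (fderiv ℂ Φ (x + z • v) v) z := fun z hz =>
    (hd _ (hmem z hz)).hasFDerivAt.comp_hasDerivAt z (hasDerivAt_line x v z)
  have h0 := (hder 0 (mem_closedBall_self (by positivity))).deriv
  rw [zero_smul, add_zero] at h0
  have hdc : DiffContOnCl ℂ (fun z : ℂ => Φ (x + z • v)) (ball 0 (ρ / ‖v‖)) :=
    DifferentiableOn.diffContOnCl fun z hz =>
      (hder z (closure_ball_subset_closedBall hz)).differentiableAt.differentiableWithinAt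
  have := Complex.norm_deriv_le_of_forall_mem_sphere_norm_le (by positivity : 0 < ρ / ‖v‖) hdc
    fun z hz => hC _ (hmem z (sphere_subset_closedBall hz))
  rw [h0] at this
  exact this.trans_eq (by field_simp)

/-- Cauchy's formula on the line through `x` in direction `v`. The right side involves `x` only
through values of `Φ`, so it can be differentiated in `x` under the integral sign. -/
theorem fderiv_apply_eq_integral {Φ : E → ℂ} {x v : E} {r : ℝ} (hr : 0 < r)
    (hd : ∀ z ∈ closedBall (0 : ℂ) r, DifferentiableAt ℂ Φ (x + z • v)) :
    fderiv ℂ Φ x v = (2 * Real.pi * Complex.I)⁻¹ *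
      ∫ θ in (0 : ℝ)..2 * Real.pi, deriv (circleMap 0 r) θ * (1 / circleMap 0 r θ ^ 2) *
        Φ (x + circleMap 0 r θ • v) := by
  have hder : ∀ z ∈ closedBall (0 : ℂ) r,
      HasDerivAt (fun z : ℂ => Φ (x + z • v)) (fderiv ℂ Φ (x + z • v) v) z := fun z hz =>
    (hd _ hz).hasFDerivAt.comp_hasDerivAt z (hasDerivAt_line x v z)
  have h0 := (hder 0 (mem_closedBall_self hr.le)).deriv
  rw [zero_smul, add_zero] at h0
  have hdc : DifferentiableOn ℂ (fun z : ℂ => Φ (x + z • v)) (closedBall 0 r) := fun z hz =>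
    (hder z hz).differentiableAt.differentiableWithinAt
  have h := hdc.deriv_eq_smul_circleIntegral hr
  rw [h0, smul_eq_mul] at h
  rw [eq_inv_mul_iff_mul_eq₀ Complex.two_pi_I_ne_zero, ← h, circleIntegral]
  simp only [sub_zero, smul_eq_mul, mul_assoc]

variable [FiniteDimensional ℂ E]

/-- Differentiation under the integral in Cauchy's formula. Compactness of closed balls in finite
dimension bounds `Φ`, and Cauchy's estimate turns this into the dominating bound on `fderiv ℂ Φ`. -/
theorem differentiableAt_fderiv_apply {Φ : E → ℂ} {U : Set E} (hU : IsOpen U)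
    (hΦ : DifferentiableOn ℂ Φ U) {x₀ : E} (hx₀ : x₀ ∈ U) (v : E) :
    DifferentiableAt ℂ (fun x => fderiv ℂ Φ x v) x₀ := by
  have : ProperSpace E := FiniteDimensional.proper ℂ E
  let : MeasurableSpace E := borel E
  have : BorelSpace E := ⟨rfl⟩
  have : ProperSpace (E →L[ℂ] ℂ) := FiniteDimensional.proper ℂ _
  obtain ⟨ρ, hρ, hsub⟩ : ∃ ρ > 0, closedBall x₀ ρ ⊆ U :=
    nhds_basis_closedBall.mem_iff.mp (hU.mem_nhds hx₀)
  obtain ⟨C, hC⟩ := (isCompact_closedBall x₀ ρ).exists_bound_of_continuousOn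
    (hΦ.continuousOn.mono hsub)
  have hdiff : ∀ y ∈ closedBall x₀ ρ, DifferentiableAt ℂ Φ y := fun y hy =>
    (hΦ y (hsub hy)).differentiableAt (hU.mem_nhds (hsub hy))
  -- Base points within `ρ / 4` and displacements of at most `ρ / 4` stay in the ball of radius `ρ /
  -- 2`, which leaves room `ρ / 2` for Cauchy's estimate. The `+ 1` in the witness covers `v = 0`.
  obtain ⟨r, hr, hrv⟩ : ∃ r > 0, r * ‖v‖ ≤ ρ / 4 := by
    refine ⟨ρ / 4 / (‖v‖ + 1), by positivity, ?_⟩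
    rw [div_mul_eq_mul_div, div_le_iff₀ (by positivity)]
    gcongr
    linarith
  have hmem : ∀ x ∈ ball x₀ (ρ / 4), ∀ z ∈ closedBall (0 : ℂ) r,
      x + z • v ∈ closedBall x₀ (ρ / 2) := by
    intro x hx z hz
    rw [mem_closedBall_zero_iff] at hz
    rw [mem_ball, dist_eq_norm] at hx
    rw [mem_closedBall, dist_eq_norm, add_sub_right_comm]
    have : ‖z • v‖ ≤ r * ‖v‖ := by rw [norm_smul]; gcongr
    exact (norm_add_le _ _).trans (by linarith)
  have hsub' : closedBall x₀ (ρ / 2) ⊆ closedBall x₀ ρ := closedBall_subset_closedBall (by linarith)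
  have hbound : ∀ y ∈ closedBall x₀ (ρ / 2), ‖fderiv ℂ Φ y‖ ≤ C / (ρ / 2) := by
    intro y hy
    have : closedBall y (ρ / 2) ⊆ closedBall x₀ ρ :=
      closedBall_subset_closedBall' (by rw [mem_closedBall] at hy; linarith)
    exact norm_fderiv_le_of_norm_le (by positivity) (fun w hw => hdiff w (this hw))
      fun w hw => hC w (this hw)
  have hcirc : ∀ θ, circleMap 0 r θ ∈ closedBall (0 : ℂ) r := fun θ =>
    circleMap_mem_closedBall 0 hr.le θ
  set k : ℝ → ℂ := fun θ => deriv (circleMap 0 r) θ * (1 / circleMap 0 r θ ^ 2) with hk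
  have hkc : Continuous k := by
    have : ∀ θ, circleMap 0 r θ ^ 2 ≠ 0 := fun θ => pow_ne_zero 2 (by simp [hr.ne'])
    have hc := continuous_circleMap 0 r
    simp only [hk, deriv_circleMap]
    fun_prop (disch := assumption)
  have hcont : ∀ x ∈ ball x₀ (ρ / 4), Continuous fun θ => k θ * Φ (x + circleMap 0 r θ • v) := by
    intro x hx
    refine hkc.mul (continuous_iff_continuousAt.mpr fun θ => ?_)
    exact ContinuousAt.comp (f := fun θ => x + circleMap 0 r θ • v)
      (hdiff _ (hsub' (hmem x hx _ (hcirc θ)))).continuousAt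
      ((continuous_circleMap 0 r).smul continuous_const |>.const_add x).continuousAt
  have hnhds : ball x₀ (ρ / 4) ∈ 𝓝 x₀ := ball_mem_nhds x₀ (by positivity)
  have key := intervalIntegral.hasFDerivAt_integral_of_dominated_of_fderiv_le (𝕜 := ℂ)
    (μ := volume) (a := 0) (b := 2 * Real.pi)
    (F := fun x θ => k θ * Φ (x + circleMap 0 r θ • v))
    (F' := fun x θ => k θ • fderiv ℂ Φ (x + circleMap 0 r θ • v))
    (bound := fun θ => ‖k θ‖ * (C / (ρ / 2))) hnhds
    (by filter_upwards [hnhds] with x hx using (hcont x hx).aestronglyMeasurable)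
    ((hcont x₀ (mem_of_mem_nhds hnhds)).intervalIntegrable _ _)
    (by
      refine AEStronglyMeasurable.smul hkc.aestronglyMeasurable ?_
      -- Continuity of the derivative is not yet known, but `fderiv` is measurable for any function.
      have : Measurable fun θ => fderiv ℂ Φ (x₀ + circleMap 0 r θ • v) :=
        (measurable_fderiv ℂ Φ).comp
          ((continuous_circleMap 0 r).smul continuous_const |>.const_add x₀).measurable
      exact this.aestronglyMeasurable)
    (by
      refine Eventually.of_forall fun θ _ x hx => ?_
      rw [norm_smul]
      exact mul_le_mul_of_nonneg_left (hbound _ (hmem x hx _ (hcirc θ))) (norm_nonneg _))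
    ((hkc.norm.mul continuous_const).intervalIntegrable _ _)
    (by
      refine Eventually.of_forall fun θ _ x hx => ?_
      have h1 := (hdiff _ (hsub' (hmem x hx _ (hcirc θ)))).hasFDerivAt
      have h2 : HasFDerivAt (fun y => y + circleMap 0 r θ • v) (ContinuousLinearMap.id ℂ E) x :=
        (hasFDerivAt_id x).add_const _
      exact (h1.comp x h2).const_mul (k θ))
  refine (key.differentiableAt.const_mul (2 * Real.pi * Complex.I)⁻¹).congr_of_eventuallyEq ?_
  filter_upwards [hnhds] with x hx
  exact fderiv_apply_eq_integral hr fun z hz => hdiff _ (hsub' (hmem x hx z hz))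

/-- The derivative of a holomorphic function of several variables is holomorphic. -/
theorem differentiableAt_fderiv {Φ : E → ℂ} {U : Set E} (hU : IsOpen U)
    (hΦ : DifferentiableOn ℂ Φ U) {x : E} (hx : x ∈ U) :
    DifferentiableAt ℂ (fderiv ℂ Φ) x := by
  -- Coordinates identify a functional with its values on a basis, which reduces the claim to
  -- evaluations at fixed vectors.
  let e₁ : E ≃L[ℂ] (Fin (Module.finrank ℂ E) → ℂ) := ContinuousLinearEquiv.ofFinrankEq (by simp)
  let e₂ := (e₁.arrowCongr (1 : ℂ ≃L[ℂ] ℂ)).trans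
    (ContinuousLinearEquiv.piRing (Fin (Module.finrank ℂ E)))
  rw [← Function.id_comp (fderiv ℂ Φ), ← e₂.symm_comp_self]
  exact e₂.symm.differentiableAt.comp x
    (differentiableAt_pi.mpr fun i => differentiableAt_fderiv_apply hU hΦ hx _)

theorem fderiv_fderiv_symm {Φ : E → ℂ} {U : Set E} (hU : IsOpen U)
    (hΦ : DifferentiableOn ℂ Φ U) {x : E} (hx : x ∈ U) (v w : E) :
    fderiv ℂ (fderiv ℂ Φ) x v w = fderiv ℂ (fderiv ℂ Φ) x w v := by
  refine second_derivative_symmetric_of_eventually (𝕜 := ℂ) (f := Φ) ?_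
    (differentiableAt_fderiv hU hΦ hx).hasFDerivAt v w
  filter_upwards [hU.mem_nhds hx] with y hy
  exact ((hΦ y hy).differentiableAt (hU.mem_nhds hy)).hasFDerivAt

end SeveralVariables

/-! ### The Poisson tensor on gradients -/

/-- The bivector underlying both brackets: on invariant functions with Euclidean gradients
`α = (∂F/∂g, ∂F/∂L)` and `β = (∂H/∂g, ∂H/∂L)` at `(g, L)`, its value with `M = L + c` is
`{F, H}₂ + c {F, H}₁`. -/
noncomputable def tensor {n : ℕ} (g M : Mat n) (α β : Mat n × Mat n) : ℂ :=
  1 / 2 * (trace (g * α.1 * (M * β.2 + β.2 * M)) - trace (g * β.1 * (M * α.2 + α.2 * M))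
    + trace (M * M * (α.2 * β.2 - β.2 * α.2)))

/-- The derivative of `tensor` with respect to its base point. -/
noncomputable def tensorDeriv {n : ℕ} (g M g' M' : Mat n) (α β : Mat n × Mat n) : ℂ :=
  1 / 2 * (trace (g' * α.1 * (M * β.2 + β.2 * M)) + trace (g * α.1 * (M' * β.2 + β.2 * M'))
    - (trace (g' * β.1 * (M * α.2 + α.2 * M)) + trace (g * β.1 * (M' * α.2 + α.2 * M')))
    + trace ((M' * M + M * M') * (α.2 * β.2 - β.2 * α.2)))

/-- The first component of the Hamiltonian vector field of a function with gradient `α`. -/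
noncomputable def hamFst {n : ℕ} (g M : Mat n) (α : Mat n × Mat n) : Mat n :=
  (1 / 2 : ℂ) • ((M * α.2 + α.2 * M) * g)

/-- The second component of the Hamiltonian vector field of a function with gradient `α`. -/
noncomputable def hamSnd {n : ℕ} (g M : Mat n) (α : Mat n × Mat n) : Mat n :=
  (1 / 2 : ℂ) • (α.2 * (M * M) - M * M * α.2 - (M * (g * α.1) + g * α.1 * M))

theorem tensor_antisymm {n : ℕ} (g M : Mat n) (α β : Mat n × Mat n) :
    tensor g M α β = -tensor g M β α := by
  simp only [tensor, mul_sub, trace_sub]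
  ring

theorem tensor_eq_pairing_ham {n : ℕ} (g M : Mat n) (α β : Mat n × Mat n) :
    tensor g M α β = trace (α.1 * hamFst g M β) + trace (α.2 * hamSnd g M β) := by
  -- Each trace word contains exactly one component of `α`. Rotating all other letters away from the
  -- front gives a normal form beginning with that component.
  have h : ∀ X, trace (g * X) = trace (X * g) := trace_mul_comm g
  have h' : ∀ X, trace (β.1 * X) = trace (X * β.1) := trace_mul_comm β.1
  have h'' : ∀ X, trace (β.2 * X) = trace (X * β.2) := trace_mul_comm β.2
  have hM : ∀ X, trace (M * X) = trace (X * M) := trace_mul_comm M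
  simp only [tensor, hamFst, hamSnd, mul_add, add_mul, mul_sub, mul_assoc, trace_add,
    trace_sub, Matrix.mul_smul, trace_smul, smul_eq_mul, h, h', h'', hM]
  ring

theorem trace_mul_cycle_invariant {n : ℕ} (g p₁ p₂ p₃ : Mat n) :
    trace (p₁ * g * (p₂ * g) * (p₃ * g)) = trace (g * p₁ * (g * p₂) * (g * p₃)) := by
  rw [← mul_assoc _ p₃ g, trace_mul_comm _ g]
  simp only [mul_assoc]

/-- The obstruction to the Jacobi identity for `tensor` is the difference of the Cartan `3`-form
evaluated on left and right gradients. -/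
theorem cyclic_tensorDeriv {n : ℕ} (g M : Mat n) (α β γ : Mat n × Mat n) :
    4 * (tensorDeriv g M (hamFst g M γ) (hamSnd g M γ) α β
      + tensorDeriv g M (hamFst g M α) (hamSnd g M α) β γ
      + tensorDeriv g M (hamFst g M β) (hamSnd g M β) γ α)
    = trace ((g * α.1 + (M * α.2 - α.2 * M)) * (g * β.1 + (M * β.2 - β.2 * M))
          * (g * γ.1 + (M * γ.2 - γ.2 * M)))
      - trace ((g * β.1 + (M * β.2 - β.2 * M)) * (g * α.1 + (M * α.2 - α.2 * M))
          * (g * γ.1 + (M * γ.2 - γ.2 * M)))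
      - (trace (g * α.1 * (g * β.1) * (g * γ.1)) - trace (g * β.1 * (g * α.1) * (g * γ.1))) := by
  obtain ⟨p₁, d₁⟩ := α
  obtain ⟨p₂, d₂⟩ := β
  obtain ⟨p₃, d₃⟩ := γ
  -- Again a normal form for cyclic words: each contains exactly one of `p₁`, `d₁`, and every other
  -- letter is rotated away from the front.
  have hM : ∀ X, trace (M * X) = trace (X * M) := trace_mul_comm M
  have hg : ∀ X, trace (g * X) = trace (X * g) := trace_mul_comm g
  have hp₂ : ∀ X, trace (p₂ * X) = trace (X * p₂) := trace_mul_comm p₂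
  have hp₃ : ∀ X, trace (p₃ * X) = trace (X * p₃) := trace_mul_comm p₃
  have hd₂ : ∀ X, trace (d₂ * X) = trace (X * d₂) := trace_mul_comm d₂
  have hd₃ : ∀ X, trace (d₃ * X) = trace (X * d₃) := trace_mul_comm d₃
  simp only [tensorDeriv, hamFst, hamSnd, mul_add, add_mul, mul_sub, sub_mul, mul_assoc, trace_add,
    trace_sub, Matrix.mul_smul, Matrix.smul_mul, trace_smul, smul_eq_mul, smul_add, smul_sub,
    hM, hg, hp₂, hp₃, hd₂, hd₃]
  ring

/-- The hypotheses replace each shifted left gradient by a right gradient. The Cartan form takes the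
same value on left and right gradients, because a single `g` can be moved around the trace. -/
theorem cyclic_tensorDeriv_eq_zero {n : ℕ} {g M : Mat n} {α β γ : Mat n × Mat n}
    (hα : α.1 * g = g * α.1 + (M * α.2 - α.2 * M)) (hβ : β.1 * g = g * β.1 + (M * β.2 - β.2 * M))
    (hγ : γ.1 * g = g * γ.1 + (M * γ.2 - γ.2 * M)) :
    tensorDeriv g M (hamFst g M γ) (hamSnd g M γ) α β
      + tensorDeriv g M (hamFst g M α) (hamSnd g M α) β γ
      + tensorDeriv g M (hamFst g M β) (hamSnd g M β) γ α = 0 := by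
  have h := cyclic_tensorDeriv g M α β γ
  rw [← hα, ← hβ, ← hγ, trace_mul_cycle_invariant, trace_mul_cycle_invariant, sub_self] at h
  exact (mul_eq_zero.mp h).resolve_left (by norm_num)

/-! ### Euclidean gradients of holomorphic functions -/

section Gradients

open scoped Matrix.Norms.Operator

/-- The open set `GL(n, ℂ) × gl(n, ℂ)` inside the vector space of pairs of matrices. -/
abbrev unitSet (n : ℕ) : Set (Mat n × Mat n) := {p | IsUnit p.1}

theorem isOpen_unitSet (n : ℕ) : IsOpen (unitSet n) := Units.isOpen.preimage continuous_fst

/-- The embedding of the phase space in the vector space of pairs of matrices. -/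
def toPair {n : ℕ} (p : Phase n) : Mat n × Mat n := ((p.1 : Mat n), p.2)

theorem toPair_mem {n : ℕ} (p : Phase n) : toPair p ∈ unitSet n := p.1.isUnit

open Classical in
/-- The extension by zero of a function on the phase space to all pairs of matrices. -/
noncomputable def extendUnits {n : ℕ} (F : Phase n → ℂ) (x : Mat n × Mat n) : ℂ :=
  if h : IsUnit x.1 then F (h.unit, x.2) else 0

theorem extendUnits_toPair {n : ℕ} (F : Phase n → ℂ) (p : Phase n) :
    extendUnits F (toPair p) = F p := by
  have h : IsUnit (p.1 : Mat n) := p.1.isUnit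
  rw [extendUnits, dif_pos (show IsUnit (toPair p).1 from h)]
  exact congrArg F (Prod.ext (Units.ext rfl) rfl)

theorem exists_toPair {n : ℕ} {x : Mat n × Mat n} (hx : x ∈ unitSet n) : ∃ p, toPair p = x :=
  ⟨(IsUnit.unit hx, x.2), rfl⟩

theorem extendUnits_eqOn {n : ℕ} {F : Phase n → ℂ} {Φ : Mat n × Mat n → ℂ}
    (h : ∀ p, F p = Φ (toPair p)) : Set.EqOn (extendUnits F) Φ (unitSet n) := by
  intro x hx
  obtain ⟨p, rfl⟩ := exists_toPair hx
  rw [extendUnits_toPair, h]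

/-- The extension supplied by `IsHol` is arbitrary off the invertible matrices. Passing to
`extendUnits` makes the Euclidean gradient a function of `F` alone. -/
theorem IsHol.differentiableOn {n : ℕ} {F : Phase n → ℂ} (hF : IsHol F) :
    DifferentiableOn ℂ (extendUnits F) (unitSet n) := by
  obtain ⟨Φ, h1, h2⟩ := hF
  exact h1.congr (extendUnits_eqOn fun p => h2 p.1 p.2)

theorem IsHol.hasFDerivAt {n : ℕ} {F : Phase n → ℂ} (hF : IsHol F) (p : Phase n) :
    HasFDerivAt (extendUnits F) (fderiv ℂ (extendUnits F) (toPair p)) (toPair p) :=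
  ((hF.differentiableOn _ (toPair_mem p)).differentiableAt
    ((isOpen_unitSet n).mem_nhds (toPair_mem p))).hasFDerivAt

theorem extendUnits_add {n : ℕ} (F H : Phase n → ℂ) :
    extendUnits (F + H) = extendUnits F + extendUnits H := by
  funext x
  by_cases h : IsUnit x.1 <;> simp [extendUnits, h]

theorem extendUnits_mul {n : ℕ} (F H : Phase n → ℂ) :
    extendUnits (F * H) = extendUnits F * extendUnits H := by
  funext x
  by_cases h : IsUnit x.1 <;> simp [extendUnits, h]

theorem extendUnits_smul {n : ℕ} (c : ℂ) (F : Phase n → ℂ) :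
    extendUnits (c • F) = c • extendUnits F := by
  funext x
  by_cases h : IsUnit x.1 <;> simp [extendUnits, h]

/-- The pair of matrices that represents the derivative of `Φ` by the trace form. -/
noncomputable def gradient {n : ℕ} (Φ : Mat n × Mat n → ℂ) (x : Mat n × Mat n) : Mat n × Mat n :=
  (Matrix.of fun i j => fderiv ℂ Φ x (Matrix.single j i 1, 0),
    Matrix.of fun i j => fderiv ℂ Φ x (0, Matrix.single j i 1))

theorem fderiv_eq_trace_gradient {n : ℕ} (Φ : Mat n × Mat n → ℂ) (x v : Mat n × Mat n) :
    fderiv ℂ Φ x v = trace ((gradient Φ x).1 * v.1) + trace ((gradient Φ x).2 * v.2) := by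
  have h1 := trace_dual ((fderiv ℂ Φ x).toLinearMap ∘ₗ LinearMap.inl ℂ (Mat n) (Mat n)) v.1
  have h2 := trace_dual ((fderiv ℂ Φ x).toLinearMap ∘ₗ LinearMap.inr ℂ (Mat n) (Mat n)) v.2
  have h : v = (v.1, 0) + (0, v.2) := by simp
  conv_lhs => rw [h, map_add]
  exact (congrArg₂ (· + ·) h1 h2).symm

theorem eq_of_trace_mul_eq {n : ℕ} {A B : Mat n} (h : ∀ X, trace (A * X) = trace (B * X)) :
    A = B := Matrix.ext_iff_trace_mul_right.mpr h

/-- The chain rule along curves, in terms of gradients. -/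
theorem IsHol.hasDerivAt_comp {n : ℕ} {F : Phase n → ℂ} (hF : IsHol F) {p : Phase n}
    {c : ℂ → Mat n × Mat n} {v : Mat n × Mat n} (hc : HasDerivAt c v 0) (h0 : c 0 = toPair p) :
    HasDerivAt (fun z => extendUnits F (c z))
      (trace ((gradient (extendUnits F) (toPair p)).1 * v.1) +
        trace ((gradient (extendUnits F) (toPair p)).2 * v.2)) 0 := by
  have h := hF.hasFDerivAt p
  rw [← h0] at h
  have h' : HasDerivAt (fun z => extendUnits F (c z))
      (fderiv ℂ (extendUnits F) (c 0) v) 0 := h.comp_hasDerivAt (0 : ℂ) hc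
  rwa [fderiv_eq_trace_gradient, h0] at h'

/-- The curve `exp (zX) g` has velocity `X g`. Passing to Euclidean gradients makes the brackets
polynomial in the base point and the gradients, ready to be differentiated again. -/
theorem grad1_eq {n : ℕ} {F : Phase n → ℂ} (hF : IsHol F) (p : Phase n) :
    grad1 F p = (p.1 : Mat n) * (gradient (extendUnits F) (toPair p)).1 := by
  refine eq_of_trace_mul_eq fun X => ?_
  have hc : HasDerivAt (fun z : ℂ => toPair (expGL (z • X) * p.1, p.2))
      (X * (p.1 : Mat n), 0) 0 :=
    ((hasDerivAt_expGL X).mul_const _).prodMk (hasDerivAt_const _ _)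
  have h := hF.hasDerivAt_comp hc (by simp [expGL, toPair] : _ = toPair p)
  simp only [extendUnits_toPair, mul_zero, trace_zero, add_zero] at h
  rw [mul_assoc, trace_mul_comm (p.1 : Mat n), mul_assoc]
  exact (pairing_grad1 hF p X).unique h

theorem grad1'_eq {n : ℕ} {F : Phase n → ℂ} (hF : IsHol F) (p : Phase n) :
    grad1' F p = (gradient (extendUnits F) (toPair p)).1 * (p.1 : Mat n) := by
  refine eq_of_trace_mul_eq fun X => ?_
  have hc : HasDerivAt (fun z : ℂ => toPair (p.1 * expGL (z • X), p.2))
      ((p.1 : Mat n) * X, 0) 0 :=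
    ((hasDerivAt_expGL X).const_mul _).prodMk (hasDerivAt_const _ _)
  have h := hF.hasDerivAt_comp hc (by simp [expGL, toPair] : _ = toPair p)
  simp only [extendUnits_toPair, mul_zero, trace_zero, add_zero] at h
  rw [mul_assoc]
  exact (pairing_grad1' hF p X).unique h

theorem d2_eq {n : ℕ} {F : Phase n → ℂ} (hF : IsHol F) (p : Phase n) :
    d2 F p = (gradient (extendUnits F) (toPair p)).2 := by
  refine eq_of_trace_mul_eq fun X => ?_
  have hc : HasDerivAt (fun z : ℂ => toPair (p.1, p.2 + z • X)) (0, X) 0 :=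
    (hasDerivAt_const (0 : ℂ) (p.1 : Mat n)).prodMk (hasDerivAt_line p.2 X 0)
  have h := hF.hasDerivAt_comp hc (by simp [toPair] : _ = toPair p)
  simp only [extendUnits_toPair, mul_zero, trace_zero, zero_add] at h
  exact (pairing_d2 hF p X).unique h

/-! ### Gradients of invariant functions -/

theorem holInv_conj {n : ℕ} (F : holInv n) (η : GL (Fin n) ℂ) (p : Phase n) :
    F.1 (η * p.1 * η⁻¹, (η : Mat n) * p.2 * ((η⁻¹ : GL (Fin n) ℂ) : Mat n)) = F.1 p :=
  F.2.2 η p.1 p.2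

/-- Infinitesimal invariance under conjugation. -/
theorem gradient_invariant {n : ℕ} (F : holInv n) (p : Phase n) :
    (gradient (extendUnits F.1) (toPair p)).1 * (p.1 : Mat n) =
      (p.1 : Mat n) * (gradient (extendUnits F.1) (toPair p)).1 +
        (p.2 * (gradient (extendUnits F.1) (toPair p)).2 -
          (gradient (extendUnits F.1) (toPair p)).2 * p.2) := by
  set α := gradient (extendUnits F.1) (toPair p) with hα
  have hinv : ∀ (z : ℂ) (X : Mat n), ((expGL (z • X))⁻¹ : GL (Fin n) ℂ) = expGL (z • -X) := by
    intro z X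
    refine inv_eq_of_mul_eq_one_right (Units.ext ?_)
    rw [smul_neg]
    exact (Matrix.exp_add_of_commute _ _ (Commute.refl (z • X)).neg_right).symm.trans (by simp)
  refine eq_of_trace_mul_eq fun X => ?_
  have hexp := hasDerivAt_expGL X
  have hexp' := hasDerivAt_expGL (-X)
  -- The function is constant along this orbit curve, so its gradient annihilates the velocity `([X,
  -- g], [X, L])`.
  have hc : HasDerivAt (fun z : ℂ => toPair (expGL (z • X) * p.1 * (expGL (z • X))⁻¹,
      (expGL (z • X) : Mat n) * p.2 * (((expGL (z • X))⁻¹ : GL (Fin n) ℂ) : Mat n)))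
      (X * (p.1 : Mat n) - (p.1 : Mat n) * X, X * p.2 - p.2 * X) 0 := by
    simp only [hinv]
    have h1 := (hexp.mul_const (p.1 : Mat n)).mul hexp'
    have h2 := (hexp.mul_const p.2).mul hexp'
    have h := h1.prodMk h2
    simp only [zero_smul, expGL, IsUnit.unit_spec, NormedSpace.exp_zero, one_mul, mul_one,
      mul_neg, ← sub_eq_add_neg] at h
    exact h
  have h := F.2.1.hasDerivAt_comp hc (p := p) (by rw [hinv]; simp [expGL, toPair])
  rw [← hα] at h
  simp only [extendUnits_toPair] at h
  have hconst : ∀ z : ℂ, F.1 (expGL (z • X) * p.1 * (expGL (z • X))⁻¹,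
      (expGL (z • X) : Mat n) * p.2 * (((expGL (z • X))⁻¹ : GL (Fin n) ℂ) : Mat n)) = F.1 p :=
    fun z => holInv_conj F _ p
  simp only [hconst] at h
  have h' := h.unique (hasDerivAt_const (0 : ℂ) (F.1 p))
  have e : ∀ Y : Mat n, trace (X * Y) = trace (Y * X) := trace_mul_comm X
  have e1 : trace (α.1 * (X * (p.1 : Mat n))) = trace ((p.1 : Mat n) * (α.1 * X)) := by
    rw [← mul_assoc, trace_mul_comm]
  have e2 : trace (α.2 * (X * p.2)) = trace (p.2 * (α.2 * X)) := by
    rw [← mul_assoc, trace_mul_comm]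
  simp only [mul_sub, trace_sub, e1, e2] at h'
  simp only [add_mul, sub_mul, mul_assoc, trace_add, trace_sub]
  linear_combination -h'

/-- Equivariance of the gradient of an invariant function. -/
theorem gradient_conj {n : ℕ} (F : holInv n) (η : GL (Fin n) ℂ) (p : Phase n) :
    gradient (extendUnits F.1)
        (toPair (η * p.1 * η⁻¹, (η : Mat n) * p.2 * ((η⁻¹ : GL (Fin n) ℂ) : Mat n))) =
      ((η : Mat n) * (gradient (extendUnits F.1) (toPair p)).1 * ((η⁻¹ : GL (Fin n) ℂ) : Mat n),
        (η : Mat n) * (gradient (extendUnits F.1) (toPair p)).2 *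
          ((η⁻¹ : GL (Fin n) ℂ) : Mat n)) := by
  set q : Phase n := (η * p.1 * η⁻¹, (η : Mat n) * p.2 * ((η⁻¹ : GL (Fin n) ℂ) : Mat n)) with hq
  have h2 : (η : Mat n) * ((η⁻¹ : GL (Fin n) ℂ) : Mat n) = 1 := by simp
  set α := gradient (extendUnits F.1) (toPair p)
  set β := gradient (extendUnits F.1) (toPair q)
  have key : ∀ X Y : Mat n, trace (α.1 * X) + trace (α.2 * Y) =
      trace (β.1 * ((η : Mat n) * X * ((η⁻¹ : GL (Fin n) ℂ) : Mat n))) +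
        trace (β.2 * ((η : Mat n) * Y * ((η⁻¹ : GL (Fin n) ℂ) : Mat n))) := by
    intro X Y
    have hX := hasDerivAt_line (p.1 : Mat n) X 0
    have hY := hasDerivAt_line p.2 Y 0
    have ha := F.2.1.hasDerivAt_comp (p := p) (hX.prodMk hY) (by simp [toPair])
    have hb := F.2.1.hasDerivAt_comp (p := q)
      (((hX.const_mul (η : Mat n)).mul_const ((η⁻¹ : GL (Fin n) ℂ) : Mat n)).prodMk
        ((hY.const_mul (η : Mat n)).mul_const ((η⁻¹ : GL (Fin n) ℂ) : Mat n)))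
      (by simp [toPair, hq])
    refine ha.unique (hb.congr_of_eventuallyEq ?_)
    -- Invariance compares the affine curve with its conjugate only where the first component is
    -- invertible, which holds near `z = 0`.
    have : ∀ᶠ z : ℂ in nhds 0, IsUnit ((p.1 : Mat n) + z • X) := by
      refine hX.continuousAt.eventually_mem (Units.isOpen.mem_nhds ?_)
      simp
    filter_upwards [this] with z hz
    obtain ⟨s, hs⟩ := exists_toPair (x := ((p.1 : Mat n) + z • X, p.2 + z • Y)) hz
    have h1 : (s.1 : Mat n) = (p.1 : Mat n) + z • X := congrArg Prod.fst hs
    have h2 : s.2 = p.2 + z • Y := congrArg Prod.snd hs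
    rw [← h1, ← h2]
    exact (extendUnits_toPair F.1 s).trans
      ((holInv_conj F η s).symm.trans (extendUnits_toPair F.1 _).symm)
  have hcyc : ∀ A X : Mat n, trace ((η : Mat n) * A * ((η⁻¹ : GL (Fin n) ℂ) : Mat n) * X) =
      trace (A * (((η⁻¹ : GL (Fin n) ℂ) : Mat n) * X * (η : Mat n))) := by
    intro A X
    rw [mul_assoc, mul_assoc, trace_mul_comm]
    simp only [mul_assoc]
  have hback : ∀ X : Mat n, (η : Mat n) * (((η⁻¹ : GL (Fin n) ℂ) : Mat n) * X * (η : Mat n)) *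
      ((η⁻¹ : GL (Fin n) ℂ) : Mat n) = X := by
    intro X
    rw [mul_assoc, mul_assoc, mul_assoc, h2, mul_one, ← mul_assoc, h2, one_mul]
  refine Prod.ext (eq_of_trace_mul_eq fun X => ?_) (eq_of_trace_mul_eq fun X => ?_)
  · have := key (((η⁻¹ : GL (Fin n) ℂ) : Mat n) * X * (η : Mat n)) 0
    simp only [hback, mul_zero, zero_mul, trace_zero, add_zero] at this
    rw [hcyc, this]
  · have := key 0 (((η⁻¹ : GL (Fin n) ℂ) : Mat n) * X * (η : Mat n))
    simp only [hback, mul_zero, zero_mul, trace_zero, zero_add] at this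
    rw [hcyc, this]

end Gradients

/-! ### The brackets of invariant functions in terms of the Poisson tensor -/

/-- The trace form pairs the entry `(i, j)` with `(j, i)`, and `r` acts on these with opposite
signs. -/
theorem pairing_rMat {n : ℕ} (X Y : Mat n) : pairing (rMat X) Y = -pairing X (rMat Y) := by
  simp only [pairing, rMat, upperPart, lowerPart, trace, diag_apply, mul_apply, Matrix.smul_apply,
    Matrix.sub_apply, of_apply, smul_eq_mul]
  rw [← Finset.sum_neg_distrib]
  refine Finset.sum_congr rfl fun i _ => ?_
  rw [← Finset.sum_neg_distrib]
  refine Finset.sum_congr rfl fun j _ => ?_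
  rcases lt_trichotomy i j with h | h | h
  · simp [h, h.not_gt]; ring
  · simp [h]
  · simp [h, h.not_gt]; ring

theorem rMat_add {n : ℕ} (X Y : Mat n) : rMat (X + Y) = rMat X + rMat Y := by
  ext i j
  simp only [rMat, upperPart, lowerPart, Matrix.smul_apply, Matrix.sub_apply, Matrix.add_apply, of_apply, smul_eq_mul]
  split_ifs <;> ring

theorem rMat_sub {n : ℕ} (X Y : Mat n) : rMat (X - Y) = rMat X - rMat Y := by
  ext i j
  simp only [rMat, upperPart, lowerPart, Matrix.smul_apply, Matrix.sub_apply, of_apply, smul_eq_mul]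
  split_ifs <;> ring

/-- On invariant functions the second bracket does not depend on the `r`-matrix. -/
theorem rMat_cancellation {n : ℕ} {A A' B B' a a' b b' : Mat n} (hA : A' = A + (B - B'))
    (ha : a' = a + (b - b')) :
    pairing (rMat A) a - pairing (rMat A') a' + pairing (B - B') (rPlus b' - rMinus b)
      + pairing A (rPlus b' - rMinus b) - pairing a (rPlus B' - rMinus B)
    = 1 / 2 * (pairing A' (b + b') - pairing a (B + B')) := by
  -- This separates the `r`-part, which cancels by skewness, from the half-identity part, which
  -- survives.
  have e : ∀ X Y : Mat n, rPlus Y - rMinus X = rMat Y - rMat X + (1 / 2 : ℂ) • (X + Y) := by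
    intro X Y
    simp only [rPlus, rMinus, smul_add]
    abel
  have hr : ∀ X Y : Mat n, trace (rMat X * Y) = -trace (X * rMat Y) := pairing_rMat
  have hlow : ∀ x Y : Mat n, trace (x * rMat Y) = -trace (Y * rMat x) := fun x Y => by
    rw [← hr, trace_mul_comm]
  simp only [hA, ha, e, pairing, rMat_add, rMat_sub, mul_add, add_mul, mul_sub, sub_mul, hr,
    trace_add, trace_sub, Matrix.mul_smul, trace_smul, smul_eq_mul, hlow a]
  ring

/-- The bracket `{F, H}₂ + c {F, H}₁` of invariant functions. -/
noncomputable def pencil {n : ℕ} (c : ℂ) (F H : Phase n → ℂ) (p : Phase n) : ℂ :=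
  tensor (p.1 : Mat n) (p.2 + c • 1) (gradient (extendUnits F) (toPair p))
    (gradient (extendUnits H) (toPair p))

/-- After the `r`-terms cancel, one `∇₁'F` remains. Writing it as `∇₁F + [L, d₂F]` produces the term
`tr (L² [d₂F, d₂H])`. -/
theorem bracket2_eq_pencil {n : ℕ} (F H : holInv n) : bracket2 F.1 H.1 = pencil 0 F.1 H.1 := by
  funext p
  have hA := gradient_invariant F p
  have ha := gradient_invariant H p
  rw [← grad1_eq F.2.1, ← grad1'_eq F.2.1, ← d2_eq F.2.1] at hA
  rw [← grad1_eq H.2.1, ← grad1'_eq H.2.1, ← d2_eq H.2.1] at ha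
  have h := rMat_cancellation (B := grad2 F.1 p) (B' := grad2' F.1 p) (b := grad2 H.1 p)
    (b' := grad2' H.1 p) hA ha
  refine h.trans ?_
  rw [hA]
  have hL : ∀ X, trace (p.2 * X) = trace (X * p.2) := trace_mul_comm p.2
  have hd : ∀ X, trace (d2 H.1 p * X) = trace (X * d2 H.1 p) := trace_mul_comm _
  simp only [pencil, tensor, ← grad1_eq F.2.1, ← d2_eq F.2.1, ← grad1_eq H.2.1, ← d2_eq H.2.1,
    zero_smul, add_zero, pairing, grad2, grad2', mul_add, add_mul, mul_sub, sub_mul, mul_assoc,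
    trace_add, trace_sub, hL, hd]
  ring

/-- In the expansion of `tensor` at `L + c`, the coefficient of `c` is the first bracket and that of
`c²` is a multiple of the trace of a commutator, hence zero. -/
theorem bracket1_eq_pencil {n : ℕ} {F H : Phase n → ℂ} (hF : IsHol F) (hH : IsHol H) (c : ℂ) :
    pencil c F H = pencil 0 F H + c • bracket1 F H := by
  funext p
  have hd : ∀ X, trace (d2 F p * X) = trace (X * d2 F p) := trace_mul_comm _
  simp only [Pi.add_apply, Pi.smul_apply, smul_eq_mul, pencil, tensor, ← grad1_eq hF, ← d2_eq hF,
    ← grad1_eq hH, ← d2_eq hH, zero_smul, add_zero, bracket1, pairing, mul_add, add_mul, mul_sub,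
    mul_assoc, trace_add, trace_sub, Matrix.mul_smul, Matrix.smul_mul, one_mul, mul_one, trace_smul,
    hd]
  ring

/-! ### The pencil as an operation on invariant functions -/

section Holomorphy

open scoped Matrix.Norms.Operator

theorem differentiableAt_gradient {n : ℕ} {F : Phase n → ℂ} (hF : IsHol F) {x : Mat n × Mat n}
    (hx : x ∈ unitSet n) : DifferentiableAt ℂ (gradient (extendUnits F)) x := by
  have h := fun v => differentiableAt_fderiv_apply (isOpen_unitSet n) hF.differentiableOn hx v
  exact DifferentiableAt.prodMk
    (differentiableAt_pi.mpr fun i => differentiableAt_pi.mpr fun j => h _)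
    (differentiableAt_pi.mpr fun i => differentiableAt_pi.mpr fun j => h _)

theorem hasDerivAt_trace {n : ℕ} {c : ℂ → Mat n} {c' : Mat n} {z : ℂ} (hc : HasDerivAt c c' z) :
    HasDerivAt (fun z => trace (c z)) (trace c') z :=
  ((LinearMap.toContinuousLinearMap (traceLinearMap (Fin n) ℂ ℂ)).hasFDerivAt).comp_hasDerivAt z hc

theorem differentiableAt_trace {n : ℕ} {E : Type*} [NormedAddCommGroup E] [NormedSpace ℂ E]
    {f : E → Mat n} {x : E} (hf : DifferentiableAt ℂ f x) :
    DifferentiableAt ℂ (fun y => trace (f y)) x :=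
  ((LinearMap.toContinuousLinearMap (traceLinearMap (Fin n) ℂ ℂ)).differentiableAt).comp x hf

/-- The extension of `pencil c F H` to pairs of matrices. -/
noncomputable def pencilExt {n : ℕ} (c : ℂ) (F H : Phase n → ℂ) (x : Mat n × Mat n) : ℂ :=
  tensor x.1 (x.2 + c • 1) (gradient (extendUnits F) x) (gradient (extendUnits H) x)

theorem differentiableAt_pencilExt {n : ℕ} (c : ℂ) {F H : Phase n → ℂ} (hF : IsHol F)
    (hH : IsHol H) {x : Mat n × Mat n} (hx : x ∈ unitSet n) :
    DifferentiableAt ℂ (pencilExt c F H) x := by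
  have h1 := (differentiableAt_gradient hF hx).fst
  have h2 := (differentiableAt_gradient hF hx).snd
  have k1 := (differentiableAt_gradient hH hx).fst
  have k2 := (differentiableAt_gradient hH hx).snd
  have hg : DifferentiableAt ℂ (fun y : Mat n × Mat n => y.1) x := differentiableAt_fst
  have hM : DifferentiableAt ℂ (fun y : Mat n × Mat n => y.2 + c • (1 : Mat n)) x :=
    differentiableAt_snd.add_const _
  exact ((((differentiableAt_trace ((hg.mul h1).mul ((hM.mul k2).add (k2.mul hM)))).sub
    (differentiableAt_trace ((hg.mul k1).mul ((hM.mul h2).add (h2.mul hM))))).add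
    (differentiableAt_trace ((hM.mul hM).mul ((h2.mul k2).sub (k2.mul h2)))))).const_mul (1 / 2)

theorem isHol_pencil {n : ℕ} (c : ℂ) {F H : Phase n → ℂ} (hF : IsHol F) (hH : IsHol H) :
    IsHol (pencil c F H) :=
  ⟨pencilExt c F H, fun _ hx => (differentiableAt_pencilExt c hF hH hx).differentiableWithinAt,
    fun _ _ => rfl⟩

/-- The Poisson tensor is invariant under conjugation. -/
theorem tensor_conj {n : ℕ} (η : GL (Fin n) ℂ) (g M : Mat n) (α β : Mat n × Mat n) :
    tensor ((η : Mat n) * g * ((η⁻¹ : GL (Fin n) ℂ) : Mat n))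
      ((η : Mat n) * M * ((η⁻¹ : GL (Fin n) ℂ) : Mat n))
      ((η : Mat n) * α.1 * ((η⁻¹ : GL (Fin n) ℂ) : Mat n),
        (η : Mat n) * α.2 * ((η⁻¹ : GL (Fin n) ℂ) : Mat n))
      ((η : Mat n) * β.1 * ((η⁻¹ : GL (Fin n) ℂ) : Mat n),
        (η : Mat n) * β.2 * ((η⁻¹ : GL (Fin n) ℂ) : Mat n)) = tensor g M α β := by
  have hη : ((η⁻¹ : GL (Fin n) ℂ) : Mat n) * (η : Mat n) = 1 := by simp
  have hm : ∀ X Y : Mat n, (η : Mat n) * X * ((η⁻¹ : GL (Fin n) ℂ) : Mat n) *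
      ((η : Mat n) * Y * ((η⁻¹ : GL (Fin n) ℂ) : Mat n)) =
      (η : Mat n) * (X * Y) * ((η⁻¹ : GL (Fin n) ℂ) : Mat n) := by
    intro X Y
    rw [mul_assoc, ← mul_assoc _ ((η : Mat n) * Y), ← mul_assoc _ (η : Mat n) Y, hη, one_mul]
    simp only [mul_assoc]
  have ht : ∀ X : Mat n,
      trace ((η : Mat n) * X * ((η⁻¹ : GL (Fin n) ℂ) : Mat n)) = trace X := by
    intro X
    rw [trace_mul_comm, ← mul_assoc, hη, one_mul]
  simp only [tensor, hm, ← mul_add, ← add_mul, ← mul_sub, ← sub_mul, ht]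

theorem pencil_conj {n : ℕ} (c : ℂ) (F H : holInv n) (η : GL (Fin n) ℂ) (p : Phase n) :
    pencil c F.1 H.1 (η * p.1 * η⁻¹, (η : Mat n) * p.2 * ((η⁻¹ : GL (Fin n) ℂ) : Mat n)) =
      pencil c F.1 H.1 p := by
  have h : (η : Mat n) * p.2 * ((η⁻¹ : GL (Fin n) ℂ) : Mat n) + c • 1 =
      (η : Mat n) * (p.2 + c • 1) * ((η⁻¹ : GL (Fin n) ℂ) : Mat n) := by
    simp [mul_add, add_mul]
  simp only [pencil, gradient_conj, h]
  exact tensor_conj η _ _ _ _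

/-- The bracket `{F, H}₂ + c {F, H}₁` as an operation on invariant holomorphic functions. -/
noncomputable def pencilInv {n : ℕ} (c : ℂ) (F H : holInv n) : holInv n :=
  ⟨pencil c F.1 H.1, isHol_pencil c F.2.1 H.2.1, fun η g L => pencil_conj c F H η (g, L)⟩

/-! ### The Poisson property -/

theorem gradient_add {n : ℕ} {F H : Phase n → ℂ} (hF : IsHol F) (hH : IsHol H) (p : Phase n) :
    gradient (extendUnits (F + H)) (toPair p) =
      gradient (extendUnits F) (toPair p) + gradient (extendUnits H) (toPair p) := by
  have h := ((hF.hasFDerivAt p).add (hH.hasFDerivAt p)).fderiv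
  rw [← extendUnits_add] at h
  exact Prod.ext (Matrix.ext fun i j => DFunLike.congr_fun h (Matrix.single j i 1, 0))
    (Matrix.ext fun i j => DFunLike.congr_fun h (0, Matrix.single j i 1))

theorem gradient_smul {n : ℕ} (c : ℂ) {F : Phase n → ℂ} (hF : IsHol F) (p : Phase n) :
    gradient (extendUnits (c • F)) (toPair p) = c • gradient (extendUnits F) (toPair p) := by
  have h := ((hF.hasFDerivAt p).const_smul c).fderiv
  rw [← extendUnits_smul] at h
  exact Prod.ext (Matrix.ext fun i j => DFunLike.congr_fun h (Matrix.single j i 1, 0))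
    (Matrix.ext fun i j => DFunLike.congr_fun h (0, Matrix.single j i 1))

theorem gradient_mul {n : ℕ} {F H : Phase n → ℂ} (hF : IsHol F) (hH : IsHol H) (p : Phase n) :
    gradient (extendUnits (F * H)) (toPair p) =
      F p • gradient (extendUnits H) (toPair p) + H p • gradient (extendUnits F) (toPair p) := by
  have h := ((hF.hasFDerivAt p).mul (hH.hasFDerivAt p)).fderiv
  rw [← extendUnits_mul, extendUnits_toPair, extendUnits_toPair] at h
  exact Prod.ext (Matrix.ext fun i j => DFunLike.congr_fun h (Matrix.single j i 1, 0))
    (Matrix.ext fun i j => DFunLike.congr_fun h (0, Matrix.single j i 1))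

theorem tensor_add_left {n : ℕ} (g M : Mat n) (α α' β : Mat n × Mat n) :
    tensor g M (α + α') β = tensor g M α β + tensor g M α' β := by
  simp only [tensor, Prod.fst_add, Prod.snd_add, mul_add, add_mul, mul_sub, trace_add, trace_sub]
  ring

theorem tensor_smul_left {n : ℕ} (g M : Mat n) (c : ℂ) (α β : Mat n × Mat n) :
    tensor g M (c • α) β = c * tensor g M α β := by
  simp only [tensor, Prod.smul_fst, Prod.smul_snd, Matrix.mul_smul, Matrix.smul_mul, mul_add,
    mul_sub, trace_add, trace_sub, trace_smul, smul_eq_mul]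
  ring

/-! ### Second derivatives and iterated brackets. -/

theorem hasDerivAt_gradient {n : ℕ} {F : Phase n → ℂ} (hF : IsHol F) (p : Phase n)
    (v : Mat n × Mat n) :
    HasDerivAt (fun z : ℂ => gradient (extendUnits F) (toPair p + z • v))
      (fderiv ℂ (gradient (extendUnits F)) (toPair p) v) 0 :=
  hasDerivAt_comp_line (differentiableAt_gradient hF (toPair_mem p)) v

theorem hasDerivAt_gradient_fst {n : ℕ} {F : Phase n → ℂ} (hF : IsHol F) (p : Phase n)
    (v : Mat n × Mat n) :
    HasDerivAt (fun z : ℂ => (gradient (extendUnits F) (toPair p + z • v)).1)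
      (fderiv ℂ (gradient (extendUnits F)) (toPair p) v).1 0 :=
  (ContinuousLinearMap.fst ℂ (Mat n) (Mat n)).hasFDerivAt.comp_hasDerivAt 0
    (hasDerivAt_gradient hF p v)

theorem hasDerivAt_gradient_snd {n : ℕ} {F : Phase n → ℂ} (hF : IsHol F) (p : Phase n)
    (v : Mat n × Mat n) :
    HasDerivAt (fun z : ℂ => (gradient (extendUnits F) (toPair p + z • v)).2)
      (fderiv ℂ (gradient (extendUnits F)) (toPair p) v).2 0 :=
  (ContinuousLinearMap.snd ℂ (Mat n) (Mat n)).hasFDerivAt.comp_hasDerivAt 0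
    (hasDerivAt_gradient hF p v)

theorem hasDerivAt_tensor {n : ℕ} {g M : ℂ → Mat n} {α β : ℂ → Mat n × Mat n} {g' M' : Mat n}
    {α' β' : Mat n × Mat n} (hg : HasDerivAt g g' 0) (hM : HasDerivAt M M' 0)
    (h1 : HasDerivAt (fun z => (α z).1) α'.1 0) (h2 : HasDerivAt (fun z => (α z).2) α'.2 0)
    (k1 : HasDerivAt (fun z => (β z).1) β'.1 0) (k2 : HasDerivAt (fun z => (β z).2) β'.2 0) :
    HasDerivAt (fun z => tensor (g z) (M z) (α z) (β z))
      (tensorDeriv (g 0) (M 0) g' M' (α 0) (β 0) + tensor (g 0) (M 0) α' (β 0) +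
        tensor (g 0) (M 0) (α 0) β') 0 := by
  have h := (((hasDerivAt_trace ((hg.fun_mul h1).fun_mul
    ((hM.fun_mul k2).fun_add (k2.fun_mul hM)))).fun_sub
    (hasDerivAt_trace ((hg.fun_mul k1).fun_mul
      ((hM.fun_mul h2).fun_add (h2.fun_mul hM))))).fun_add
    (hasDerivAt_trace ((hM.fun_mul hM).fun_mul
      ((h2.fun_mul k2).fun_sub (k2.fun_mul h2))))).const_mul (1 / 2 : ℂ)
  refine h.congr_deriv ?_
  simp only [tensorDeriv, tensor, mul_add, add_mul, mul_sub, trace_add, trace_sub]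
  ring

/-- The derivative of the bracket of two functions in terms of their second derivatives. -/
theorem fderiv_pencilExt {n : ℕ} (c : ℂ) {F H : Phase n → ℂ} (hF : IsHol F) (hH : IsHol H)
    (p : Phase n) (v : Mat n × Mat n) :
    fderiv ℂ (pencilExt c F H) (toPair p) v =
      tensorDeriv (p.1 : Mat n) (p.2 + c • 1) v.1 v.2 (gradient (extendUnits F) (toPair p))
          (gradient (extendUnits H) (toPair p))
        + tensor (p.1 : Mat n) (p.2 + c • 1) (fderiv ℂ (gradient (extendUnits F)) (toPair p) v)
          (gradient (extendUnits H) (toPair p))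
        + tensor (p.1 : Mat n) (p.2 + c • 1) (gradient (extendUnits F) (toPair p))
          (fderiv ℂ (gradient (extendUnits H)) (toPair p) v) := by
  have hl : HasDerivAt (fun z : ℂ => pencilExt c F H (toPair p + z • v))
      (fderiv ℂ (pencilExt c F H) (toPair p) v) 0 :=
    hasDerivAt_comp_line (differentiableAt_pencilExt c hF hH (toPair_mem p)) v
  have hg : HasDerivAt (fun z : ℂ => (toPair p + z • v).1) v.1 0 := hasDerivAt_line _ _ _
  have hM : HasDerivAt (fun z : ℂ => (toPair p + z • v).2 + c • (1 : Mat n)) v.2 0 :=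
    (hasDerivAt_line p.2 v.2 0).add_const _
  have h0 : toPair p + (0 : ℂ) • v = toPair p := by simp
  have h := hl.unique (hasDerivAt_tensor hg hM (hasDerivAt_gradient_fst hF p v)
    (hasDerivAt_gradient_snd hF p v) (hasDerivAt_gradient_fst hH p v)
    (hasDerivAt_gradient_snd hH p v))
  rwa [h0] at h

theorem fderiv_fderiv_eq {n : ℕ} {F : Phase n → ℂ} (hF : IsHol F) (p : Phase n)
    (v w : Mat n × Mat n) :
    fderiv ℂ (fderiv ℂ (extendUnits F)) (toPair p) v w =
      trace ((fderiv ℂ (gradient (extendUnits F)) (toPair p) v).1 * w.1) +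
        trace ((fderiv ℂ (gradient (extendUnits F)) (toPair p) v).2 * w.2) := by
  have hl : HasDerivAt (fun z : ℂ => fderiv ℂ (extendUnits F) (toPair p + z • v) w)
      (fderiv ℂ (fderiv ℂ (extendUnits F)) (toPair p) v w) 0 :=
    (ContinuousLinearMap.apply ℂ ℂ w).hasFDerivAt.comp_hasDerivAt 0 (hasDerivAt_comp_line
      (differentiableAt_fderiv (isOpen_unitSet n) hF.differentiableOn (toPair_mem p)) v)
  have h := (hasDerivAt_trace ((hasDerivAt_gradient_fst hF p v).mul_const w.1)).add
    (hasDerivAt_trace ((hasDerivAt_gradient_snd hF p v).mul_const w.2))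
  refine hl.unique (h.congr_of_eventuallyEq (Filter.Eventually.of_forall fun z => ?_))
  exact fderiv_eq_trace_gradient _ _ _

/-- The Hamiltonian vector field of an invariant function with respect to the pencil. -/
noncomputable def hamField {n : ℕ} (c : ℂ) (F : Phase n → ℂ) (p : Phase n) : Mat n × Mat n :=
  (hamFst (p.1 : Mat n) (p.2 + c • 1) (gradient (extendUnits F) (toPair p)),
    hamSnd (p.1 : Mat n) (p.2 + c • 1) (gradient (extendUnits F) (toPair p)))

/-- By antisymmetry the iterated bracket is minus the derivative of `{G, H}` along the Hamiltonian
field of `F`. The product rule hits the base point or one of the two gradients; the latter cases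
give Hessians evaluated on Hamiltonian fields. -/
theorem pencil_pencil {n : ℕ} (c : ℂ) {F G H : Phase n → ℂ} (hG : IsHol G)
    (hH : IsHol H) (p : Phase n) :
    pencil c F (pencil c G H) p =
      -(tensorDeriv (p.1 : Mat n) (p.2 + c • 1) (hamField c F p).1 (hamField c F p).2
          (gradient (extendUnits G) (toPair p)) (gradient (extendUnits H) (toPair p))
        + fderiv ℂ (fderiv ℂ (extendUnits G)) (toPair p) (hamField c F p) (hamField c H p)
        - fderiv ℂ (fderiv ℂ (extendUnits H)) (toPair p) (hamField c F p) (hamField c G p)) := by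
  have hext : extendUnits (pencil c G H) =ᶠ[nhds (toPair p)] pencilExt c G H :=
    (extendUnits_eqOn (Φ := pencilExt c G H) fun _ => rfl).eventuallyEq_of_mem
      ((isOpen_unitSet n).mem_nhds (toPair_mem p))
  have hfd := hext.fderiv_eq (𝕜 := ℂ)
  rw [pencil, tensor_antisymm, tensor_eq_pairing_ham]
  have h := fderiv_eq_trace_gradient (extendUnits (pencil c G H)) (toPair p) (hamField c F p)
  rw [hfd, fderiv_pencilExt c hG hH] at h
  rw [fderiv_fderiv_eq hG, fderiv_fderiv_eq hH]
  rw [tensor_antisymm _ _ (gradient (extendUnits G) (toPair p)), tensor_eq_pairing_ham,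
    tensor_eq_pairing_ham] at h
  simp only [hamField] at h ⊢
  rw [← h]
  ring

/-- The Jacobi identity for the pencil of brackets on invariant functions. -/
theorem pencil_jacobi {n : ℕ} (c : ℂ) (F G H : holInv n) (p : Phase n) :
    pencil c F.1 (pencil c G.1 H.1) p + pencil c G.1 (pencil c H.1 F.1) p
      + pencil c H.1 (pencil c F.1 G.1) p = 0 := by
  -- The scalar matrix `c • 1` is central, so infinitesimal invariance is unchanged by the shift of
  -- `L`.
  have hinv : ∀ F : holInv n, (gradient (extendUnits F.1) (toPair p)).1 * (p.1 : Mat n) =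
      (p.1 : Mat n) * (gradient (extendUnits F.1) (toPair p)).1 +
        ((p.2 + c • 1) * (gradient (extendUnits F.1) (toPair p)).2 -
          (gradient (extendUnits F.1) (toPair p)).2 * (p.2 + c • 1)) := by
    intro F
    rw [gradient_invariant F p]
    simp [add_mul, mul_add]
  have hJ := cyclic_tensorDeriv_eq_zero (hinv G) (hinv H) (hinv F)
  have hs : ∀ (F : holInv n) (v w : Mat n × Mat n),
      fderiv ℂ (fderiv ℂ (extendUnits F.1)) (toPair p) v w =
        fderiv ℂ (fderiv ℂ (extendUnits F.1)) (toPair p) w v := fun F =>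
    fderiv_fderiv_symm (isOpen_unitSet n) F.2.1.differentiableOn (toPair_mem p)
  -- Each Hessian occurs twice, with opposite signs and swapped arguments.
  rw [pencil_pencil c G.2.1 H.2.1, pencil_pencil c H.2.1 F.2.1, pencil_pencil c F.2.1 G.2.1,
    hs F (hamField c G p) (hamField c H p), hs G (hamField c F p) (hamField c H p),
    hs H (hamField c F p) (hamField c G p)]
  simp only [hamField] at hJ ⊢
  linear_combination -hJ

theorem isPoissonBracket_pencilInv {n : ℕ} (c : ℂ) : IsPoissonBracket (pencilInv (n := n) c) where
  add_left F G H := Subtype.ext <| funext fun p => by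
    change tensor _ _ (gradient (extendUnits (F.1 + G.1)) _) _ = _
    rw [gradient_add F.2.1 G.2.1, tensor_add_left]
    rfl
  smul_left a F H := Subtype.ext <| funext fun p => by
    change tensor _ _ (gradient (extendUnits (a • F.1)) _) _ = _
    rw [gradient_smul a F.2.1, tensor_smul_left]
    rfl
  antisymm F H := Subtype.ext <| funext fun p => tensor_antisymm _ _ _ _
  leibniz F G H := Subtype.ext <| funext fun p => by
    change tensor _ _ (gradient (extendUnits (F.1 * G.1)) _) _ = _
    rw [gradient_mul F.2.1 G.2.1, tensor_add_left, tensor_smul_left, tensor_smul_left,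
      mul_comm (G.1 p)]
    rfl
  jacobi F G H := Subtype.ext <| funext fun p => pencil_jacobi c F G H p

end Holomorphy

/-! ### The dynamical `r`-matrix in coordinates -/

theorem dynR_apply_diag {n : ℕ} {Q : GL (Fin n) ℂ} (hQ : IsRegDiag Q) (X : Mat n) (i : Fin n) :
    dynR Q hQ X i i = 0 := by
  have hY := ((adSubId Q hQ).symm (offDiagPart X)).2 i
  have h := regDiag_mapsTo hQ _ ((adSubId Q hQ).symm (offDiagPart X)).2 i
  simp only [LinearMap.sub_apply, LinearMap.id_apply, Matrix.sub_apply, hY, sub_zero] at h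
  simp [dynR, h, hY]

/-- On the matrix unit `E_ij` the operator `Ad_Q` is multiplication by `q_i / q_j`. -/
theorem dynR_apply {n : ℕ} {Q : GL (Fin n) ℂ} (hQ : IsRegDiag Q) (X : Mat n) {i j : Fin n}
    (hij : i ≠ j) :
    dynR Q hQ X i j = 1 / 2 * (((Q : Mat n) i i + (Q : Mat n) j j) /
      ((Q : Mat n) i i - (Q : Mat n) j j)) * X i j := by
  have hq : (Q : Mat n) i i - (Q : Mat n) j j ≠ 0 := sub_ne_zero.mpr (hQ.2 i j hij)
  have hj := regDiag_ne_zero hQ j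
  set Y := (adSubId Q hQ).symm (offDiagPart X) with hYdef
  have h1 : Ad Q (Y : Mat n) - (Y : Mat n) = offDiagPart X := by
    have : adSubId Q hQ Y = offDiagPart X := LinearEquiv.apply_symm_apply _ _
    exact congrArg Subtype.val this
  have h2 : Ad Q (Y : Mat n) i j - (Y : Mat n) i j = X i j := by
    rw [← Matrix.sub_apply, h1]
    simp [offDiagPart, hij]
  have h3 := regDiag_ad_mul hQ (Y : Mat n) i j
  have h4 : dynR Q hQ X i j = 1 / 2 * (Ad Q (Y : Mat n) i j + (Y : Mat n) i j) := rfl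
  have h5 : Ad Q (Y : Mat n) i j = (Y : Mat n) i j + X i j := by rw [← h2]; ring
  rw [h5] at h3
  have h6 : (Y : Mat n) i j = (Q : Mat n) j j * X i j / ((Q : Mat n) i i - (Q : Mat n) j j) := by
    rw [eq_div_iff hq]
    linear_combination -h3
  rw [h4, h5, h6]
  field_simp
  ring

theorem dynR_sub {n : ℕ} {Q : GL (Fin n) ℂ} (hQ : IsRegDiag Q) (X Y : Mat n) :
    dynR Q hQ (X - Y) = dynR Q hQ X - dynR Q hQ Y := by
  ext i j
  by_cases hij : i = j
  · subst hij; simp [dynR_apply_diag]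
  · simp only [dynR_apply hQ _ hij, Matrix.sub_apply]; ring

/-- The coefficient `(q_i + q_j) / (q_i - q_j)` is odd under exchange of `i` and `j`. -/
theorem trace_dynR_mul {n : ℕ} {Q : GL (Fin n) ℂ} (hQ : IsRegDiag Q) (X Y : Mat n) :
    trace (dynR Q hQ X * Y) = -trace (X * dynR Q hQ Y) := by
  simp only [trace, diag_apply, mul_apply]
  rw [← Finset.sum_neg_distrib]
  refine Finset.sum_congr rfl fun i _ => ?_
  rw [← Finset.sum_neg_distrib]
  refine Finset.sum_congr rfl fun j _ => ?_
  by_cases hij : i = j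
  · subst hij; simp [dynR_apply_diag]
  · rw [dynR_apply hQ _ hij, dynR_apply hQ _ (Ne.symm hij),
      ← neg_sub ((Q : Mat n) i i) ((Q : Mat n) j j), div_neg]
    ring

/-! ### Derivatives of restricted functions -/

theorem redGrad1_restrict {n : ℕ} {F : Phase n → ℂ} (hF : IsHol F) (p : RegPhase n) :
    redGrad1 (restrict n F) p = Matrix.diagonal fun i => grad1 F p.1 i i := by
  refine congrArg Matrix.diagonal (funext fun i => HasDerivAt.deriv ?_)
  have h := pairing_grad1 hF p.1 (Matrix.single i i 1)
  rw [pairing, Matrix.trace_mul_single, MulOpposite.op_one, one_smul] at h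
  refine h.congr_of_eventuallyEq ?_
  have he := expGL_mul_regDiag p.1.1 p.2 (Pi.single i 1)
  rw [Matrix.diagonal_single] at he
  filter_upwards [he] with z hz
  exact Subtype.val_injective.extend_apply (restrict n F) 0
    (⟨(expGL (z • Matrix.single i i 1) * p.1.1, p.1.2), hz⟩ : RegPhase n)

theorem redD2_restrict {n : ℕ} (F : Phase n → ℂ) (p : RegPhase n) :
    redD2 (restrict n F) p = d2 F p.1 := rfl

/-- Invariance determines the off-diagonal part of `∇₁ F` at regular diagonal elements. -/
theorem grad1_eq_redGrad1_add {n : ℕ} (F : holInv n) (p : RegPhase n) :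
    grad1 F.1 p.1 = redGrad1 (restrict n F.1) p
      + dynR p.1.1 p.2 (d2 F.1 p.1 * p.1.2 - p.1.2 * d2 F.1 p.1)
      + (1 / 2 : ℂ) • (d2 F.1 p.1 * p.1.2 - p.1.2 * d2 F.1 p.1) := by
  rw [redGrad1_restrict F.2.1]
  have h := gradient_invariant F p.1
  have hd : Matrix.diagonal (Matrix.diag (p.1.1 : Mat n)) = (p.1.1 : Mat n) :=
    p.2.1.diagonal_diag
  rw [← d2_eq F.2.1, ← grad1_eq F.2.1] at h
  -- With `A = ∇₁F` and `Z = [d₂F, L]` this says `(q_i - q_j) A_ij = q_i Z_ij`, and `q_i / (q_i -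
  -- q_j) = ½ (q_i + q_j) / (q_i - q_j) + ½`. On the diagonal it forces `Z_ii = 0` and leaves `A_ii`
  -- free.
  have h' : (p.1.1 : Mat n) * (grad1 F.1 p.1 + (p.1.2 * d2 F.1 p.1 - d2 F.1 p.1 * p.1.2)) =
      grad1 F.1 p.1 * (p.1.1 : Mat n) := by
    rw [← h, grad1_eq F.2.1, mul_assoc]
  set Z := d2 F.1 p.1 * p.1.2 - p.1.2 * d2 F.1 p.1 with hZ
  rw [← neg_sub, ← hZ, ← sub_eq_add_neg] at h'
  ext i j
  have hij := congrFun (congrFun h' i) j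
  rw [← hd, Matrix.mul_diagonal, Matrix.diagonal_mul, Matrix.sub_apply, Matrix.diag_apply,
    Matrix.diag_apply] at hij
  rw [Matrix.add_apply, Matrix.add_apply, Matrix.smul_apply, smul_eq_mul]
  by_cases e : i = j
  · subst e
    have hz : Z i i = 0 := by
      have := regDiag_ne_zero p.2 i
      have h0 : (p.1.1 : Mat n) i i * Z i i = 0 := by linear_combination -hij
      exact (mul_eq_zero.mp h0).resolve_left this
    rw [dynR_apply_diag, hz, Matrix.diagonal_apply_eq]
    ring
  · have hq : (p.1.1 : Mat n) i i - (p.1.1 : Mat n) j j ≠ 0 := sub_ne_zero.mpr (p.2.2 i j e)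
    rw [dynR_apply p.2 _ e, Matrix.diagonal_apply_ne _ e]
    field_simp
    linear_combination 2 * hij

/-! ### The reduced brackets -/

/-- The terms `½ [d₂, L]` in the two gradients cancel `⟨L, [d₂F, d₂H]⟩`, and skewness of `R(Q)`
turns the rest into the dynamical bracket. -/
theorem bracket1_restrict {n : ℕ} (F H : holInv n) (p : RegPhase n) :
    bracket1 F.1 H.1 p.1 =
      pairing (redGrad1 (restrict n F.1) p) (redD2 (restrict n H.1) p)
      - pairing (redGrad1 (restrict n H.1) p) (redD2 (restrict n F.1) p)
      + pairing p.1.2 (dynBracket p.1.1 p.2 (redD2 (restrict n F.1) p)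
          (redD2 (restrict n H.1) p)) := by
  rw [bracket1, grad1_eq_redGrad1_add F, grad1_eq_redGrad1_add H, redD2_restrict, redD2_restrict]
  generalize d2 F.1 p.1 = D
  generalize d2 H.1 p.1 = d
  have hR : ∀ X Y, trace (dynR p.1.1 p.2 X * Y) = -trace (X * dynR p.1.1 p.2 Y) :=
    trace_dynR_mul p.2
  have hD : ∀ X, trace (D * X) = trace (X * D) := trace_mul_comm D
  have hd : ∀ X, trace (d * X) = trace (X * d) := trace_mul_comm d
  simp only [pairing, dynBracket, add_mul, mul_add, mul_sub, trace_add, trace_sub,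
    Matrix.smul_mul, trace_smul, smul_eq_mul, hR]
  simp only [sub_mul, mul_assoc, trace_sub, hD, hd]
  ring

/-- The halves of the commutators cancel the quadratic term in `L`. Skewness of `R(Q)` kills the
pairings of `∇₂` with `∇₂'` and doubles the unmixed ones. -/
theorem bracket2_restrict {n : ℕ} (F H : holInv n) (p : RegPhase n) :
    bracket2 F.1 H.1 p.1 =
      (1 / 2 : ℂ) * pairing (redGrad1 (restrict n F.1) p)
          (redGrad2 (restrict n H.1) p + redGrad2' (restrict n H.1) p)
      - (1 / 2 : ℂ) * pairing (redGrad1 (restrict n H.1) p)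
          (redGrad2 (restrict n F.1) p + redGrad2' (restrict n F.1) p)
      + pairing (redGrad2 (restrict n F.1) p)
          (dynR p.1.1 p.2 (redGrad2 (restrict n H.1) p))
      - pairing (redGrad2' (restrict n F.1) p)
          (dynR p.1.1 p.2 (redGrad2' (restrict n H.1) p)) := by
  rw [bracket2_eq_pencil]
  simp only [pencil, tensor, ← grad1_eq F.2.1, ← d2_eq F.2.1, ← grad1_eq H.2.1, ← d2_eq H.2.1,
    zero_smul, add_zero]
  rw [grad1_eq_redGrad1_add F, grad1_eq_redGrad1_add H]
  simp only [redGrad2, redGrad2', redD2_restrict]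
  generalize d2 F.1 p.1 = D
  generalize d2 H.1 p.1 = d
  generalize p.1.2 = L
  have hR : ∀ X Y, trace (dynR p.1.1 p.2 X * Y) = -trace (X * dynR p.1.1 p.2 Y) :=
    trace_dynR_mul p.2
  have hs : ∀ X, trace (d * L * dynR p.1.1 p.2 X) = -trace (X * dynR p.1.1 p.2 (d * L)) :=
    fun X => by rw [← hR, trace_mul_comm]
  have hs' : ∀ X, trace (L * d * dynR p.1.1 p.2 X) = -trace (X * dynR p.1.1 p.2 (L * d)) :=
    fun X => by rw [← hR, trace_mul_comm]
  have hD : ∀ X, trace (D * X) = trace (X * D) := trace_mul_comm D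
  have hL : ∀ X, trace (L * X) = trace (X * L) := trace_mul_comm L
  simp only [pairing, add_mul, mul_add, mul_sub, sub_mul, trace_add, trace_sub,
    Matrix.smul_mul, trace_smul, smul_eq_mul, dynR_sub, hR, hs, hs']
  simp only [mul_assoc, hD, hL]
  ring

/-! ### Descent of the brackets to the reduced algebra. -/

theorem restrictInv_surjective {n : ℕ} : Function.Surjective (restrictInv (n := n)) := by
  rintro ⟨f, hf⟩
  obtain ⟨F, hF, rfl⟩ := Subalgebra.mem_map.mp hf
  exact ⟨⟨F, hF⟩, rfl⟩

/-- An operation on invariant functions whose restriction only depends on the restrictions of its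
arguments descends uniquely to the reduced algebra. -/
theorem existsUnique_isReducedBracket {n : ℕ} (B : (Phase n → ℂ) → (Phase n → ℂ) → Phase n → ℂ)
    (hB : ∀ F H : holInv n, B F.1 H.1 ∈ holInv n)
    (hdep : ∀ F F' H H' : holInv n, restrictInv F = restrictInv F' →
      restrictInv H = restrictInv H' → restrict n (B F.1 H.1) = restrict n (B F'.1 H'.1)) :
    ∃! b : holRed n → holRed n → holRed n, IsReducedBracket B b := by
  choose s hs using restrictInv_surjective (n := n)
  refine ⟨fun f h => restrictInv ⟨_, hB (s f) (s h)⟩,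
    fun F H => hdep _ _ _ _ (hs _) (hs _), fun b hb => ?_⟩
  funext f h
  have := hb (s f) (s h)
  rw [hs, hs] at this
  exact Subtype.ext this

theorem bracket2_mem_holInv {n : ℕ} (F H : holInv n) : bracket2 F.1 H.1 ∈ holInv n :=
  bracket2_eq_pencil F H ▸ (pencilInv 0 F H).2

/-- As a difference of two members of the pencil, the first bracket inherits holomorphy and
invariance. -/
theorem bracket1_mem_holInv {n : ℕ} (F H : holInv n) : bracket1 F.1 H.1 ∈ holInv n := by
  have h : bracket1 F.1 H.1 = (pencilInv 1 F H - pencilInv 0 F H : holInv n).1 := by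
    change _ = pencil 1 F.1 H.1 - pencil 0 F.1 H.1
    rw [bracket1_eq_pencil F.2.1 H.2.1 1, one_smul, add_sub_cancel_left]
  exact h ▸ Subtype.property _

/-! ### Poisson pencils -/

section Pencils

variable {A : Type*} [CommRing A] [Algebra ℂ A]

/-- The bilinear and derivation properties, which are preserved by linear combinations. -/
theorem isPoissonBracket_of_jacobi {b₁ b₂ : A → A → A} (h₁ : IsPoissonBracket b₁)
    (h₂ : IsPoissonBracket b₂) (x y : ℂ)
    (hJ : ∀ f g h, x • b₁ f (x • b₁ g h + y • b₂ g h) + y • b₂ f (x • b₁ g h + y • b₂ g h)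
      + (x • b₁ g (x • b₁ h f + y • b₂ h f) + y • b₂ g (x • b₁ h f + y • b₂ h f))
      + (x • b₁ h (x • b₁ f g + y • b₂ f g) + y • b₂ h (x • b₁ f g + y • b₂ f g)) = 0) :
    IsPoissonBracket fun f h => x • b₁ f h + y • b₂ f h where
  add_left f g h := by
    simp only [h₁.add_left, h₂.add_left, smul_add]
    abel
  smul_left c f h := by
    simp only [h₁.smul_left, h₂.smul_left, smul_add]
    rw [smul_comm x c, smul_comm y c]
  antisymm f h := by
    simp only [h₁.antisymm f h, h₂.antisymm f h, smul_neg, neg_add]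
  leibniz f g h := by
    simp only [h₁.leibniz f, h₂.leibniz f, Algebra.smul_def]
    ring
  jacobi := hJ

theorem IsPoissonBracket.add_right {b : A → A → A} (hb : IsPoissonBracket b) (f g h : A) :
    b f (g + h) = b f g + b f h := by
  rw [hb.antisymm, hb.add_left, hb.antisymm g, hb.antisymm h]
  abel

theorem IsPoissonBracket.smul_right {b : A → A → A} (hb : IsPoissonBracket b) (c : ℂ) (f h : A) :
    b f (c • h) = c • b f h := by
  rw [hb.antisymm, hb.smul_left, hb.antisymm h, smul_neg, neg_neg]

/-- If `b₂ + c b₁` is a Poisson bracket for all `c`, then so is `b₁`. -/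
theorem IsPoissonBracket.of_pencil {b₁ b₂ : A → A → A}
    (h : ∀ c : ℂ, IsPoissonBracket fun f g => b₂ f g + c • b₁ f g) : IsPoissonBracket b₁ := by
  have h₂ : IsPoissonBracket b₂ := by simpa using h 0
  have h₁₂ : IsPoissonBracket fun f g => b₂ f g + b₁ f g := by simpa using h 1
  -- The axioms linear in the bracket follow by subtracting `c = 0` from `c = 1`.
  have hadd : ∀ f g k, b₁ (f + g) k = b₁ f k + b₁ g k := fun f g k => by
    linear_combination h₁₂.add_left f g k - h₂.add_left f g k
  have hanti : ∀ f k, b₁ f k = -b₁ k f := fun f k => by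
    linear_combination h₁₂.antisymm f k - h₂.antisymm f k
  have hneg : ∀ f k, b₁ f (-k) = -b₁ f k := fun f k => by
    have h0 : b₁ 0 f = 0 := by simpa using hadd 0 0 f
    have := hadd k (-k) f
    rw [add_neg_cancel, h0, hanti k, hanti (-k)] at this
    linear_combination this
  have hadd' : ∀ f g k, b₁ f (g + k) = b₁ f g + b₁ f k := fun f g k => by
    rw [hanti, hadd, hanti g, hanti k]
    abel
  have hneg₂ : ∀ f k, b₂ f (-k) = -b₂ f k := fun f k => by
    have := h₂.smul_right (-1) f k
    rwa [neg_one_smul, neg_one_smul] at this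
  refine ⟨hadd, fun c f k => ?_, hanti, fun f g k => ?_, fun f g k => ?_⟩
  · have e₁₂ := h₁₂.smul_left c f k
    have e₂ := h₂.smul_left c f k
    simp only [Algebra.smul_def] at e₁₂ e₂ ⊢
    linear_combination e₁₂ - e₂
  · linear_combination h₁₂.leibniz f g k - h₂.leibniz f g k
  · have j1 := (h 1).jacobi f g k
    have j2 := (h (-1)).jacobi f g k
    have j0 := h₂.jacobi f g k
    simp only [one_smul, neg_one_smul, h₂.add_right, hadd', hneg, hneg₂] at j1 j2
    -- The Jacobi sum is a quadratic polynomial in `c`; its second difference over `-1, 0, 1` is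
    -- twice the leading coefficient.
    have two : (2 : ℂ) • (b₁ f (b₁ g k) + b₁ g (b₁ k f) + b₁ k (b₁ f g)) = 0 := by
      rw [two_smul]
      linear_combination j1 + j2 - 2 * j0
    exact (smul_eq_zero_iff_right two_ne_zero).mp two

/-- If `b₂ + c b₁` is a Poisson bracket for all `c`, then `b₁` and `b₂` are compatible. -/
theorem areCompatible_of_pencil {b₁ b₂ : A → A → A}
    (h : ∀ c : ℂ, IsPoissonBracket fun f g => b₂ f g + c • b₁ f g) : AreCompatible b₁ b₂ := by
  have h₁ := IsPoissonBracket.of_pencil h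
  have h₂ : IsPoissonBracket b₂ := by simpa using h 0
  refine fun x y => isPoissonBracket_of_jacobi h₁ h₂ x y fun f g k => ?_
  have j1 := (h 1).jacobi f g k
  simp only [one_smul, h₁.add_right, h₂.add_right] at j1
  simp only [h₁.add_right, h₂.add_right, h₁.smul_right, h₂.smul_right]
  simp only [Algebra.smul_def]
  have i1 := h₁.jacobi f g k
  have i2 := h₂.jacobi f g k
  -- `j1 - i1 - i2` is the mixed part of the Jacobi sum, which enters with coefficient `x y`.
  linear_combination (algebraMap ℂ A x * algebraMap ℂ A y) * (j1 - i1 - i2)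
    + algebraMap ℂ A x ^ 2 * i1 + algebraMap ℂ A y ^ 2 * i2

end Pencils

/-! ### Transfer of the Poisson property to the reduced brackets. -/

theorem isPoissonBracket_reduced_pencil {n : ℕ} {b₁ b₂ : holRed n → holRed n → holRed n}
    (h₁ : IsReducedBracket bracket1 b₁) (h₂ : IsReducedBracket bracket2 b₂) (c : ℂ) :
    IsPoissonBracket fun f g => b₂ f g + c • b₁ f g := by
  -- Restriction intertwines the pencils and is a surjective algebra map, so every axiom passes to
  -- the quotient.
  have key : ∀ F H : holInv n, b₂ (restrictInv F) (restrictInv H) +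
      c • b₁ (restrictInv F) (restrictInv H) = restrictInv (pencilInv c F H) := by
    intro F H
    refine Subtype.ext ?_
    change (b₂ (restrictInv F) (restrictInv H)).1 + c • (b₁ (restrictInv F) (restrictInv H)).1 =
      restrict n (pencil c F.1 H.1)
    rw [h₁ F H, h₂ F H, bracket1_eq_pencil F.2.1 H.2.1, bracket2_eq_pencil, map_add, map_smul]
  have hP := isPoissonBracket_pencilInv (n := n) c
  have hs := restrictInv_surjective (n := n)
  have hadd : ∀ F H : holInv n, restrictInv F + restrictInv H = restrictInv (F + H) :=
    fun _ _ => rfl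
  have hmul : ∀ F H : holInv n, restrictInv F * restrictInv H = restrictInv (F * H) :=
    fun _ _ => rfl
  have hneg : ∀ F : holInv n, -restrictInv F = restrictInv (-F) := fun _ => rfl
  constructor
  · intro f g h
    obtain ⟨F, rfl⟩ := hs f
    obtain ⟨G, rfl⟩ := hs g
    obtain ⟨H, rfl⟩ := hs h
    simp only [hadd, key, hP.add_left]
  · intro a f h
    obtain ⟨F, rfl⟩ := hs f
    obtain ⟨H, rfl⟩ := hs h
    refine (key (a • F) H).trans ?_
    rw [hP.smul_left]
    exact (congrArg (a • ·) (key F H)).symm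
  · intro f h
    obtain ⟨F, rfl⟩ := hs f
    obtain ⟨H, rfl⟩ := hs h
    simp only [key, hneg]
    exact congrArg restrictInv (hP.antisymm F H)
  · intro f g h
    obtain ⟨F, rfl⟩ := hs f
    obtain ⟨G, rfl⟩ := hs g
    obtain ⟨H, rfl⟩ := hs h
    simp only [hmul, hadd, key, hP.leibniz]
  · intro f g h
    obtain ⟨F, rfl⟩ := hs f
    obtain ⟨G, rfl⟩ := hs g
    obtain ⟨H, rfl⟩ := hs h
    simp only [key, hadd]
    exact congrArg restrictInv (hP.jacobi F G H)

/-- The bracket contains derivatives transverse to the diagonal slice, but the reduced formula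
expresses it through the restrictions alone. -/
theorem restrict_bracket1_congr {n : ℕ} (F F' H H' : holInv n)
    (hF : restrictInv F = restrictInv F') (hH : restrictInv H = restrictInv H') :
    restrict n (bracket1 F.1 H.1) = restrict n (bracket1 F'.1 H'.1) := by
  have hF' : restrict n F.1 = restrict n F'.1 := congrArg Subtype.val hF
  have hH' : restrict n H.1 = restrict n H'.1 := congrArg Subtype.val hH
  funext p
  refine (bracket1_restrict F H p).trans (Eq.trans ?_ (bracket1_restrict F' H' p).symm)
  rw [hF', hH']

theorem restrict_bracket2_congr {n : ℕ} (F F' H H' : holInv n)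
    (hF : restrictInv F = restrictInv F') (hH : restrictInv H = restrictInv H') :
    restrict n (bracket2 F.1 H.1) = restrict n (bracket2 F'.1 H'.1) := by
  have hF' : restrict n F.1 = restrict n F'.1 := congrArg Subtype.val hF
  have hH' : restrict n H.1 = restrict n H'.1 := congrArg Subtype.val hH
  funext p
  refine (bracket2_restrict F H p).trans (Eq.trans ?_ (bracket2_restrict F' H' p).symm)
  rw [hF', hH']

end SpinSutherland

theorem theorem3p4 (n : ℕ) :
    (∃! b₁ : SpinSutherland.holRed n → SpinSutherland.holRed n → SpinSutherland.holRed n,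
      SpinSutherland.IsReducedBracket SpinSutherland.bracket1 b₁) ∧
    (∃! b₂ : SpinSutherland.holRed n → SpinSutherland.holRed n → SpinSutherland.holRed n,
      SpinSutherland.IsReducedBracket SpinSutherland.bracket2 b₂) ∧
    ∀ b₁ b₂ : SpinSutherland.holRed n → SpinSutherland.holRed n → SpinSutherland.holRed n,
      SpinSutherland.IsReducedBracket SpinSutherland.bracket1 b₁ →
      SpinSutherland.IsReducedBracket SpinSutherland.bracket2 b₂ →
      (∀ (f h : SpinSutherland.holRed n) (p : SpinSutherland.RegPhase n),
        (b₁ f h : SpinSutherland.RegPhase n → ℂ) p =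
          SpinSutherland.pairing (SpinSutherland.redGrad1 f p) (SpinSutherland.redD2 h p)
          - SpinSutherland.pairing (SpinSutherland.redGrad1 h p) (SpinSutherland.redD2 f p)
          + SpinSutherland.pairing p.1.2
              (SpinSutherland.dynBracket p.1.1 p.2
                (SpinSutherland.redD2 f p) (SpinSutherland.redD2 h p))) ∧
      (∀ (f h : SpinSutherland.holRed n) (p : SpinSutherland.RegPhase n),
        (b₂ f h : SpinSutherland.RegPhase n → ℂ) p =
          (1 / 2 : ℂ) * SpinSutherland.pairing (SpinSutherland.redGrad1 f p)
              (SpinSutherland.redGrad2 h p + SpinSutherland.redGrad2' h p)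
          - (1 / 2 : ℂ) * SpinSutherland.pairing (SpinSutherland.redGrad1 h p)
              (SpinSutherland.redGrad2 f p + SpinSutherland.redGrad2' f p)
          + SpinSutherland.pairing (SpinSutherland.redGrad2 f p)
              (SpinSutherland.dynR p.1.1 p.2 (SpinSutherland.redGrad2 h p))
          - SpinSutherland.pairing (SpinSutherland.redGrad2' f p)
              (SpinSutherland.dynR p.1.1 p.2 (SpinSutherland.redGrad2' h p))) ∧
      SpinSutherland.IsPoissonBracket b₁ ∧
      SpinSutherland.IsPoissonBracket b₂ ∧
      SpinSutherland.AreCompatible b₁ b₂ := by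
  open SpinSutherland in
  refine ⟨existsUnique_isReducedBracket _ bracket1_mem_holInv restrict_bracket1_congr,
    existsUnique_isReducedBracket _ bracket2_mem_holInv restrict_bracket2_congr,
    fun b₁ b₂ h₁ h₂ => ?_⟩
  have hP := SpinSutherland.isPoissonBracket_reduced_pencil h₁ h₂
  refine ⟨fun f h p => ?_, fun f h p => ?_, SpinSutherland.IsPoissonBracket.of_pencil hP,
    by simpa using hP 0, SpinSutherland.areCompatible_of_pencil hP⟩
  · obtain ⟨F, rfl⟩ := SpinSutherland.restrictInv_surjective f
    obtain ⟨H, rfl⟩ := SpinSutherland.restrictInv_surjective h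
    exact (congrFun (h₁ F H) p).trans (SpinSutherland.bracket1_restrict F H p)
  · obtain ⟨F, rfl⟩ := SpinSutherland.restrictInv_surjective f
    obtain ⟨H, rfl⟩ := SpinSutherland.restrictInv_surjective h
    exact (congrFun (h₂ F H) p).trans (SpinSutherland.bracket2_restrict F H p)
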